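/- A real entire function $f$ belongs to the Laguerre--Pólya class $\mathcal{L\text{-}P}$ if $$f(z)=cz^n e^{-\alpha z^2+\beta z}\prod_{k}\Big(1-\frac{z}{x_k}\Big)e^{z/x_k}$$ with $c,\alpha,\beta\in\mathbb R$, $\alpha\ge 0$, $n\in\{0,1,2,\dots\}$, $x_k\in\mathbb R\setminus\{0\}$ and $\sum_k x_k^{-2}<\infty$; it belongs to the Laguerre--Pólya class of type I, $\mathcal{L\text{-}P}I$, if $$f(z)=cz^n e^{\beta z}\prod_{k}\Big(1+\frac{z}{x_k}\Big)$$ with $c\in\mathbb R$, $\beta\ge 0$, $n\in\{0,1,2,\dots\}$, $x_k>0$ and $\sum_k x_k^{-1}<\infty$. In both cases the product may be infinite, finite or empty. Let $q_\infty$ denote the partial theta constant, that is, the infimum of the numbers $\alpha^2$ over all $\alpha>1$ for which the partial theta function $g_\alpha(z)=\sum_{k=0}^\infty z^k\alpha^{-k^2}$ belongs to $\mathcal{L\text{-}P}$ (numerically, $q_\infty\approx 3.2336$). For reals $a,b>1$ write $f_{a,b}$ for any entire function $\sum_{k=0}^\infty a_kz^k$ with $a_k>0$ for all $k$ whose second quotients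 $q_n=\dfrac{a_{n-1}^2}{a_{n-2}a_n}$ $(n\ge 2)$ satisfy $q_2=q_4=q_6=\dots=a$ and $q_3=q_5=q_7=\dots=b$. **Theorem.** Let $1<a<b$, and let $f_{a,b}$ be as above. 1. If $f_{a,b}\in\mathcal{L\text{-}P}I$, then $a\ge q_\infty$. 2. If $q_\infty\le a<b$ and $f_{a,b}\in\mathcal{L\text{-}P}I$, then for every $c$ with $a<c<b$ we have $f_{a,c}\in\mathcal{L\text{-}P}I$ (for every function of that kind). 3. If $q_\infty\le a<b$ and $f_{a,b}\in\mathcal{L\text{-}P}$, then for every $d$ with $a<d<b$ we have $f_{d,b}\in\mathcal{L\text{-}P}I$ (for every function of that kind). -/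

import Mathlib

/-- `f : ℂ → ℂ` is a real entire function: entire, and real-valued on the real line. -/
def IsRealEntire (f : ℂ → ℂ) : Prop :=
  Differentiable ℂ f ∧ ∀ x : ℝ, (f (x : ℂ)).im = 0

/-- The Laguerre--Pólya class: real entire functions of the form
`c z^n exp(-α z^2 + β z) ∏_k (1 - z / x_k) exp(z / x_k)` with `c, α, β` real, `α ≥ 0`,
nonzero real `x_k`, and `∑ x_k^(-2) < ∞`. The index set `S ⊆ ℕ` of the product may be
infinite, finite or empty. -/
def LaguerrePolya (f : ℂ → ℂ) : Prop :=
  IsRealEntire f ∧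
    ∃ (c α β : ℝ) (n : ℕ) (S : Set ℕ) (x : S → ℝ) (P : ℂ → ℂ),
      0 ≤ α ∧ (∀ k, x k ≠ 0) ∧ Summable (fun k => ((x k) ^ 2)⁻¹) ∧
      (∀ z : ℂ,
        HasProd (fun k => (1 - z / (x k : ℂ)) * Complex.exp (z / (x k : ℂ))) (P z)) ∧
      ∀ z : ℂ, f z =
        (c : ℂ) * z ^ n * Complex.exp (-(α : ℂ) * z ^ 2 + (β : ℂ) * z) * P z

/-- The Laguerre--Pólya class of type I: real entire functions of the form
`c z^n exp(β z) ∏_k (1 + z / x_k)` with `c` real, `β ≥ 0`, `x_k > 0`, and `∑ x_k^(-1) < ∞`.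
The index set `S ⊆ ℕ` of the product may be infinite, finite or empty. -/
def LaguerrePolyaI (f : ℂ → ℂ) : Prop :=
  IsRealEntire f ∧
    ∃ (c β : ℝ) (n : ℕ) (S : Set ℕ) (x : S → ℝ) (P : ℂ → ℂ),
      0 ≤ β ∧ (∀ k, 0 < x k) ∧ Summable (fun k => (x k)⁻¹) ∧
      (∀ z : ℂ, HasProd (fun k => 1 + z / (x k : ℂ)) (P z)) ∧
      ∀ z : ℂ, f z = (c : ℂ) * z ^ n * Complex.exp ((β : ℂ) * z) * P z

/-- The second quotient `q_n = u_{n-1}^2 / (u_{n-2} u_n)`, meant for `n ≥ 2`. -/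
noncomputable def secondQuotient (u : ℕ → ℝ) (n : ℕ) : ℝ :=
  u (n - 1) ^ 2 / (u (n - 2) * u n)

/-- `f` is an entire function with positive Taylor coefficients at `0` whose second quotients
alternate: `q_2 = q_4 = q_6 = ⋯ = a` and `q_3 = q_5 = q_7 = ⋯ = b`. -/
def IsAlternatingQuotientFunction (a b : ℝ) (f : ℂ → ℂ) : Prop :=
  ∃ u : ℕ → ℝ, (∀ k, 0 < u k) ∧
    (∀ z : ℂ, HasSum (fun k : ℕ => (u k : ℂ) * z ^ k) (f z)) ∧
    (∀ m : ℕ, 1 ≤ m → secondQuotient u (2 * m) = a) ∧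
    (∀ m : ℕ, 1 ≤ m → secondQuotient u (2 * m + 1) = b)

/-- The partial theta function `g_a(z) = ∑_{k ≥ 0} z^k a^(-k^2)`, which is entire for `a > 1`. -/
noncomputable def partialTheta (a : ℝ) (z : ℂ) : ℂ :=
  ∑' k : ℕ, z ^ k / (a : ℂ) ^ (k ^ 2)

/-- The partial theta constant: the threshold for `a^2`, `a > 1`, at which the partial theta
function `g_a` enters the Laguerre--Pólya class. -/
noncomputable def qInfty : ℝ :=
  sInf {q : ℝ | ∃ a : ℝ, 1 < a ∧ LaguerrePolya (partialTheta a) ∧ q = a ^ 2}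

/-! Up to f(z) ↦ c f(lz) with c, l > 0, the quotients a, b determine one function, `altFun a b`. Put
Q = ab and let φ(x) be its value at -x (`altPhi`). Then φ(x) = 1 - x + (x²/a) φ(x/Q), and for 3 ≤ a
≤ b everything is decided by the sign of φ on (0, a].

Sufficiency (`laguerrePolyaI_altFun`): a negative value φ(x) with x ≤ a propagates to all Q^k x,
while φ is positive at all Q^k a√b. This gives two zeros per factor Q. Comparing growth with partial
products on the circles |z| = Q^k a√b shows that the product over these zeros is the whole function.

Necessity (`exists_altPhi_eq_zero`): for a type I function e^{βz}∏(1 + z/x_k), the Taylor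
coefficients give β + ∑ 1/x_k = 1 and ∑ 1/x_k² = 1 - 2/a. Cauchy–Schwarz for the power sums,
together with a < b, forces a > 3. Then 1 - 2/a > 1/a, so some x_k ≤ a.

Monotonicity (`altPhi_lt_altPhi_right`, `altPhi_lt_altPhi_left`): on (0, a], φ strictly increases
with b and strictly decreases with a. Hence a zero of φ in (0, a] becomes a strictly negative value
when b is lowered to some c ≥ a or a is raised to some d ≤ b, and sufficiency applies. The case c =
a is a rescaled partial theta function, which gives the bound on `qInfty`. Positive coefficients
upgrade class L-P to type I. -/

open Filter Topology

/-! ### The normalised function and its functional equation -/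

/-- Normalised coefficients: value `1` at `0` and `1`, second quotients alternately `a` and `b`. -/
noncomputable def altCoeff (a b : ℝ) : ℕ → ℝ
  | 0 => 1
  | 1 => 1
  | (k + 2) => altCoeff a b k / (a * (a * b) ^ k)

/-- The normalised function with alternating second quotients. -/
noncomputable def altFun (a b : ℝ) (z : ℂ) : ℂ := ∑' k : ℕ, (altCoeff a b k : ℂ) * z ^ k

/-- The restriction of `altFun` to the real line. -/
noncomputable def altReal (a b : ℝ) (x : ℝ) : ℝ := (altFun a b (x : ℂ)).re

theorem altCoeff_pos {a b : ℝ} (ha : 0 < a) (hb : 0 < b) : ∀ k, 0 < altCoeff a b k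
  | 0 => by simp [altCoeff]
  | 1 => by simp [altCoeff]
  | (k + 2) => by
    have := altCoeff_pos ha hb k
    rw [altCoeff]; positivity

/-- The recursion factor 1/(a(ab)^k) is geometric in k, so it cancels from the quotient and the
second quotients have period two. Only the base case sees a; in the odd case it sees b. -/
theorem altCoeff_quotient_even {a b : ℝ} (ha : 0 < a) (hb : 0 < b) (m : ℕ) :
    altCoeff a b (2 * m + 1) ^ 2 = a * (altCoeff a b (2 * m) * altCoeff a b (2 * m + 2)) := by
  induction m with
  | zero => simp [altCoeff]; field_simp
  | succ m ih =>
    have e1 : 2 * (m + 1) + 1 = (2 * m + 1) + 2 := by ring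
    have e2 : 2 * (m + 1) = 2 * m + 2 := by ring
    rw [e1, e2, altCoeff, altCoeff.eq_3 a b (2 * m + 2), div_pow, ih]
    conv_rhs => rw [show altCoeff a b (2 * m + 2) * (altCoeff a b (2 * m + 2) / (a * (a * b) ^ (2 * m + 2)))
      = (altCoeff a b (2 * m + 2) / (a * (a * b) ^ (2 * m + 2))) * altCoeff a b (2 * m + 2) by ring]
    conv_rhs => rw [altCoeff.eq_3 a b (2 * m)]
    conv_lhs => rw [altCoeff.eq_3 a b (2 * m)]
    field_simp
    ring

theorem altCoeff_quotient_odd {a b : ℝ} (ha : 0 < a) (hb : 0 < b) (m : ℕ) :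
    altCoeff a b (2 * m + 2) ^ 2 = b * (altCoeff a b (2 * m + 1) * altCoeff a b (2 * m + 3)) := by
  induction m with
  | zero => simp [altCoeff]; field_simp
  | succ m ih =>
    have e1 : 2 * (m + 1) + 1 = (2 * m + 1) + 2 := by ring
    have e2 : 2 * (m + 1) + 2 = 2 * m + 2 + 2 := by ring
    have e3 : 2 * (m + 1) + 3 = 2 * m + 3 + 2 := by ring
    rw [e1, e2, e3, altCoeff.eq_3 a b (2 * m + 2), div_pow, ih, altCoeff.eq_3 a b (2 * m + 3),
      altCoeff.eq_3 a b (2 * m + 1)]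
    field_simp
    ring

theorem eq_altCoeff {a b : ℝ} (ha : 0 < a) (hb : 0 < b) {u : ℕ → ℝ} (hu : ∀ k, 0 < u k)
    (hae : ∀ m : ℕ, 1 ≤ m → secondQuotient u (2 * m) = a)
    (hbo : ∀ m : ℕ, 1 ≤ m → secondQuotient u (2 * m + 1) = b) (k : ℕ) :
    u k = u 0 * (u 1 / u 0) ^ k * altCoeff a b k := by
  have key : ∀ m, (u (2 * m) = u 0 * (u 1 / u 0) ^ (2 * m) * altCoeff a b (2 * m)) ∧
      u (2 * m + 1) = u 0 * (u 1 / u 0) ^ (2 * m + 1) * altCoeff a b (2 * m + 1) := by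
    intro m
    have h0 := hu 0
    have h1 := hu 1
    induction m with
    | zero =>
      simp [altCoeff]; field_simp
    | succ m ih =>
      obtain ⟨i1, i2⟩ := ih
      have w0 := altCoeff_pos ha hb (2 * m)
      have w1 := altCoeff_pos ha hb (2 * m + 1)
      have w2 := altCoeff_pos ha hb (2 * m + 2)
      have w3 := altCoeff_pos ha hb (2 * m + 3)
      have A : u (2 * m + 1) ^ 2 / (u (2 * m) * u (2 * m + 2)) = a := hae (m + 1) (by omega)
      have B : u (2 * m + 2) ^ 2 / (u (2 * m + 1) * u (2 * m + 3)) = b := hbo (m + 1) (by omega)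
      have QA := altCoeff_quotient_even ha hb m
      have QB := altCoeff_quotient_odd ha hb m
      have u0 := hu (2 * m)
      have u1 := hu (2 * m + 1)
      have u2 := hu (2 * m + 2)
      have u3 := hu (2 * m + 3)
      rw [div_eq_iff (by positivity)] at A B
      set l := u 1 / u 0 with hl
      have hlp : 0 < l := by positivity
      have E2 : u (2 * m + 2) = u 0 * l ^ (2 * m + 2) * altCoeff a b (2 * m + 2) := by
        have : a * u (2 * m) * u (2 * m + 2)
            = a * u (2 * m) * (u 0 * l ^ (2 * m + 2) * altCoeff a b (2 * m + 2)) := by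
          calc a * u (2 * m) * u (2 * m + 2) = u (2 * m + 1) ^ 2 := by rw [A]; ring
            _ = (u 0 * l ^ (2 * m + 1)) ^ 2 * altCoeff a b (2 * m + 1) ^ 2 := by rw [i2]; ring
            _ = _ := by rw [QA, i1]; ring
        exact mul_left_cancel₀ (by positivity) this
      refine ⟨E2, ?_⟩
      have : b * u (2 * m + 1) * u (2 * m + 3)
            = b * u (2 * m + 1) * (u 0 * l ^ (2 * m + 3) * altCoeff a b (2 * m + 3)) := by
          calc b * u (2 * m + 1) * u (2 * m + 3) = u (2 * m + 2) ^ 2 := by rw [B]; ring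
            _ = (u 0 * l ^ (2 * m + 2)) ^ 2 * altCoeff a b (2 * m + 2) ^ 2 := by rw [E2]; ring
            _ = _ := by rw [QB, i2]; ring
      exact mul_left_cancel₀ (by positivity) this
  obtain ⟨m, rfl | rfl⟩ := k.even_or_odd'
  · exact (key m).1
  · exact (key m).2

theorem summable_altCoeff_mul_pow {a b : ℝ} (ha : 1 < a) (hb : 1 < b) {r : ℝ} (hr : 0 < r) :
    Summable (fun k => altCoeff a b k * r ^ k) := by
  have hQ : 1 < a * b := by nlinarith
  have hw := altCoeff_pos (a := a) (b := b) (by linarith) (by linarith)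
  -- The recursion has step two, so the ratio test is run on each parity class separately.
  have step : ∀ j : ℕ, Summable (fun k => altCoeff a b (2 * k + j) * r ^ (2 * k + j)) := by
    intro j
    have hev : ∀ᶠ k : ℕ in atTop, r ^ 2 / (1 / 2) ≤ (a * b) ^ k :=
      (tendsto_pow_atTop_atTop_of_one_lt hQ).eventually_ge_atTop _
    refine summable_of_ratio_norm_eventually_le (r := 1 / 2) (by norm_num) ?_
    filter_upwards [hev] with k hk
    have h1 := hw (2 * k + j)
    have h2 := hw (2 * (k + 1) + j)
    rw [Real.norm_of_nonneg (by positivity), Real.norm_of_nonneg (by positivity)]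
    rw [show 2 * (k + 1) + j = (2 * k + j) + 2 by ring, altCoeff, pow_add r]
    have : (a * b) ^ k ≤ a * (a * b) ^ (2 * k + j) :=
      calc (a * b) ^ k ≤ (a * b) ^ (2 * k + j) := pow_le_pow_right₀ hQ.le (by omega)
        _ ≤ _ := by nlinarith [show 0 < (a * b) ^ (2 * k + j) by positivity]
    have h3 : r ^ 2 / (a * (a * b) ^ (2 * k + j)) ≤ 1 / 2 := by
      rw [div_le_iff₀ (by positivity)] at hk ⊢
      linarith
    calc _ = altCoeff a b (2 * k + j) * r ^ (2 * k + j) * (r ^ 2 / (a * (a * b) ^ (2 * k + j))) := by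
            ring
      _ ≤ altCoeff a b (2 * k + j) * r ^ (2 * k + j) * (1 / 2) := by gcongr
      _ = _ := by ring
  exact ((step 0).hasSum.even_add_odd (f := fun k => altCoeff a b k * r ^ k)
    (step 1).hasSum).summable

theorem norm_altCoeff_mul_pow_le {a b : ℝ} (ha : 1 < a) (hb : 1 < b) {r : ℝ} {z : ℂ}
    (hz : ‖z‖ ≤ r) (k : ℕ) : ‖(altCoeff a b k : ℂ) * z ^ k‖ ≤ altCoeff a b k * r ^ k := by
  have hw := altCoeff_pos (a := a) (b := b) (by linarith) (by linarith) k
  rw [norm_mul, Complex.norm_of_nonneg hw.le, norm_pow]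
  gcongr

theorem summable_altFun {a b : ℝ} (ha : 1 < a) (hb : 1 < b) (z : ℂ) :
    Summable (fun k : ℕ => (altCoeff a b k : ℂ) * z ^ k) :=
  .of_norm_bounded (summable_altCoeff_mul_pow ha hb (r := ‖z‖ + 1) (by positivity))
    (norm_altCoeff_mul_pow_le ha hb (by linarith))

theorem differentiable_altFun {a b : ℝ} (ha : 1 < a) (hb : 1 < b) :
    Differentiable ℂ (altFun a b) := by
  intro z
  have : DifferentiableOn ℂ (altFun a b) (Metric.ball 0 (‖z‖ + 1)) :=
    Complex.differentiableOn_tsum_of_summable_norm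
      (summable_altCoeff_mul_pow ha hb (r := ‖z‖ + 1) (by positivity))
      (fun k => by fun_prop) Metric.isOpen_ball
      (fun k w hw => norm_altCoeff_mul_pow_le ha hb (by simpa using (Metric.mem_ball.1 hw).le) k)
  exact this.differentiableAt (Metric.isOpen_ball.mem_nhds (by simp))

/-- The two-step recursion summed over k. All later estimates iterate this equation. -/
theorem altFun_eq {a b : ℝ} (ha : 1 < a) (hb : 1 < b) (z : ℂ) :
    altFun a b z = 1 + z + z ^ 2 / a * altFun a b (z / (a * b)) := by
  have h := (summable_altFun ha hb z).sum_add_tsum_nat_add 2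
  rw [altFun, ← h, altFun, ← tsum_mul_left]
  simp only [Finset.sum_range_succ, Finset.sum_range_zero, altCoeff]
  have ha' : (a : ℂ) ≠ 0 := by norm_cast; linarith
  have hb' : (b : ℂ) ≠ 0 := by norm_cast; linarith
  congr 1
  · simp
  · refine tsum_congr fun k => ?_
    push_cast
    rw [div_pow]
    field_simp
    ring

theorem altFun_ofReal {a b : ℝ} (x : ℝ) : altFun a b (x : ℂ) = (altReal a b x : ℂ) := by
  have : altFun a b (x : ℂ) = ((∑' k, altCoeff a b k * x ^ k : ℝ) : ℂ) := by
    rw [altFun, Complex.ofReal_tsum]; push_cast; rfl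
  rw [altReal, this, Complex.ofReal_re]

theorem altReal_eq {a b : ℝ} (ha : 1 < a) (hb : 1 < b) (x : ℝ) :
    altReal a b x = 1 + x + x ^ 2 / a * altReal a b (x / (a * b)) := by
  have h := altFun_eq ha hb x
  rw [altFun_ofReal, show (x : ℂ) / (a * b) = ((x / (a * b) : ℝ) : ℂ) by push_cast; rfl,
    altFun_ofReal] at h
  exact_mod_cast h

theorem contDiff_altReal {a b : ℝ} (ha : 1 < a) (hb : 1 < b) {n : WithTop ℕ∞} :
    ContDiff ℝ n (altReal a b) :=
  (differentiable_altFun ha hb).contDiff.real_of_complex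

theorem altReal_zero {a b : ℝ} (ha : 1 < a) (hb : 1 < b) : altReal a b 0 = 1 := by
  rw [altReal_eq ha hb]; simp

theorem norm_altFun_le {a b : ℝ} (ha : 1 < a) (hb : 1 < b) {r : ℝ} {z : ℂ}
    (hr : 0 < r) (hz : ‖z‖ ≤ r) : ‖altFun a b z‖ ≤ altReal a b r := by
  have h : altReal a b r = ∑' k, altCoeff a b k * r ^ k := by
    have := altFun_ofReal (a := a) (b := b) r
    rw [altFun] at this
    exact_mod_cast this.symm
  rw [h]
  exact tsum_of_norm_bounded (summable_altCoeff_mul_pow ha hb hr).hasSum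
    (norm_altCoeff_mul_pow_le ha hb hz)

theorem one_le_altReal {a b : ℝ} (ha : 1 < a) (hb : 1 < b) {x : ℝ} (hx : 0 < x) :
    1 ≤ altReal a b x := by
  have := norm_altFun_le ha hb (z := 0) hx (by simpa using hx.le)
  rw [show (0 : ℂ) = ((0 : ℝ) : ℂ) by simp, altFun_ofReal, altReal_zero ha hb] at this
  simpa using this

theorem IsAlternatingQuotientFunction.exists_eq {a b : ℝ} (ha : 1 < a) (hb : 1 < b)
    {f : ℂ → ℂ} (hf : IsAlternatingQuotientFunction a b f) :
    ∃ c l : ℝ, 0 < c ∧ 0 < l ∧ ∀ z, f z = c * altFun a b (l * z) := by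
  obtain ⟨u, hu, hs, hae, hbo⟩ := hf
  refine ⟨u 0, u 1 / u 0, hu 0, div_pos (hu 1) (hu 0), fun z => ?_⟩
  rw [← (hs z).tsum_eq, altFun, ← tsum_mul_left]
  refine tsum_congr fun k => ?_
  rw [eq_altCoeff (by linarith) (by linarith) hu hae hbo k]
  push_cast
  ring

/-- The coefficients t^(-k²) have constant second quotient t², so t = √a corresponds to equal
parameters. -/
theorem partialTheta_eq_altFun {a : ℝ} (ha : 1 < a) (z : ℂ) :
    partialTheta (√a) z = altFun a a ((√a)⁻¹ * z) := by
  have hs : 0 < √a := by positivity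
  have hc := eq_altCoeff (a := a) (b := a) (by linarith) (by linarith)
    (u := fun k => ((√a) ^ (k ^ 2))⁻¹) (fun k => by positivity)
  have hq : ∀ n : ℕ, 2 ≤ n → secondQuotient (fun k => ((√a) ^ (k ^ 2))⁻¹) n = a := by
    intro n hn
    obtain ⟨n, rfl⟩ := Nat.exists_eq_add_of_le' hn
    simp only [secondQuotient, show n + 2 - 1 = n + 1 by omega, show n + 2 - 2 = n by omega]
    rw [div_eq_iff (by positivity)]
    field_simp
    obtain ⟨s, hs', rfl⟩ : ∃ s : ℝ, √a = s ∧ a = s ^ 2 :=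
      ⟨√a, rfl, (Real.sq_sqrt (by linarith)).symm⟩
    rw [hs', ← pow_add, ← pow_mul, ← pow_add]
    congr 1; ring
  have hc := hc (fun m hm => hq _ (by omega)) (fun m hm => hq _ (by omega))
  rw [partialTheta, altFun]
  refine tsum_congr fun k => ?_
  have h := congrArg (fun x : ℝ => (x : ℂ)) (hc k)
  push_cast at h
  rw [div_eq_mul_inv, h]
  simp
  ring

/-! ### The function on the negative half-line -/

/-- The normalised alternating-sign function `x ↦ altReal a b (-x)`. -/
noncomputable def altPhi (a b x : ℝ) : ℝ := altReal a b (-x)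

theorem altPhi_eq {a b : ℝ} (ha : 1 < a) (hb : 1 < b) (x : ℝ) :
    altPhi a b x = 1 - x + x ^ 2 / a * altPhi a b (x / (a * b)) := by
  rw [altPhi, altReal_eq ha hb, altPhi, neg_div]; ring

theorem altPhi_zero {a b : ℝ} (ha : 1 < a) (hb : 1 < b) : altPhi a b 0 = 1 := by
  rw [altPhi, neg_zero, altReal_zero ha hb]

theorem contDiff_altPhi {a b : ℝ} (ha : 1 < a) (hb : 1 < b) {n : WithTop ℕ∞} :
    ContDiff ℝ n (altPhi a b) :=
  (contDiff_altReal ha hb).comp contDiff_neg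

theorem differentiable_altPhi {a b : ℝ} (ha : 1 < a) (hb : 1 < b) :
    Differentiable ℝ (altPhi a b) :=
  (contDiff_altPhi ha hb (n := 1)).differentiable (by simp)

theorem continuous_altPhi {a b : ℝ} (ha : 1 < a) (hb : 1 < b) : Continuous (altPhi a b) :=
  (differentiable_altPhi ha hb).continuous

theorem deriv_altPhi_eq {a b : ℝ} (ha : 1 < a) (hb : 1 < b) (x : ℝ) :
    deriv (altPhi a b) x = -1 + 2 * x / a * altPhi a b (x / (a * b))
      + x ^ 2 / (a * (a * b)) * deriv (altPhi a b) (x / (a * b)) := by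
  have h1 : HasDerivAt (altPhi a b) (deriv (altPhi a b) (x / (a * b))) (x / (a * b)) :=
    (differentiable_altPhi ha hb _).hasDerivAt
  have h2 : HasDerivAt (fun x : ℝ => altPhi a b (x / (a * b)))
      (deriv (altPhi a b) (x / (a * b)) * (1 / (a * b))) x :=
    HasDerivAt.comp (h₂ := altPhi a b) x h1 ((hasDerivAt_id x).div_const (a * b))
  have h3 : HasDerivAt (fun x : ℝ => 1 - x + x ^ 2 / a * altPhi a b (x / (a * b))) _ x :=
    ((hasDerivAt_id' x).const_sub 1).add (((hasDerivAt_pow 2 x).div_const a).mul h2)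
  have h4 : altPhi a b = fun x : ℝ => 1 - x + x ^ 2 / a * altPhi a b (x / (a * b)) :=
    funext (altPhi_eq ha hb)
  rw [← h4] at h3
  rw [h3.deriv]
  have : a ≠ 0 := by linarith
  have : b ≠ 0 := by linarith
  simp only [Nat.cast_ofNat, Nat.add_one_sub_one, pow_one]
  field_simp
  ring

/-- A property that holds near `0` and passes from `y / Q` to `y` holds on `[0, 1]`. -/
theorem forall_unitInterval_of_step {Q : ℝ} (hQ : 1 < Q) {p : ℝ → Prop}
    (h0 : ∀ᶠ y in 𝓝 (0 : ℝ), p y) (step : ∀ y, 0 ≤ y → y ≤ 1 → p (y / Q) → p y)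
    {y : ℝ} (hy : 0 ≤ y) (hy1 : y ≤ 1) : p y := by
  have ht : Tendsto (fun n : ℕ => y * Q⁻¹ ^ n) atTop (𝓝 0) := by
    simpa using (tendsto_pow_atTop_nhds_zero_of_lt_one (by positivity)
      (inv_lt_one_of_one_lt₀ hQ)).const_mul y
  obtain ⟨n, hn⟩ := (ht.eventually h0).exists
  induction n generalizing y with
  | zero => simpa using hn
  | succ n ih =>
    apply step y hy hy1
    have hd : y / Q ≤ 1 := (div_le_self hy hQ.le).trans hy1
    refine ih (by positivity) hd ?_ ?_
    · simpa using (tendsto_pow_atTop_nhds_zero_of_lt_one (by positivity)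
        (inv_lt_one_of_one_lt₀ hQ)).const_mul (y / Q)
    · rwa [div_eq_mul_inv, mul_assoc, ← pow_succ']

/-! ### Bounds on [0, 1] and monotonicity in the parameters -/

section Bounds

variable {a b : ℝ}

theorem altPhi_mem {y : ℝ} (ha : 3 ≤ a) (hb : 1 < b) (hy : 0 ≤ y) (hy1 : y ≤ 1) :
    0 ≤ altPhi a b y ∧ altPhi a b y ≤ 1 := by
  have ha1 : 1 < a := by linarith
  have hQ : 1 < a * b := by nlinarith
  -- Since φ(0) = 1, the bound φ ≤ 1 is not available on a neighbourhood of 0 by continuity alone.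
  -- The weaker bound 2 is, and one step sharpens it to 1 because y²/a ≤ y/3.
  have step : ∀ y, 0 ≤ y → y ≤ 1 → (0 ≤ altPhi a b (y / (a * b)) ∧ altPhi a b (y / (a * b)) ≤ 2) →
      (0 ≤ altPhi a b y ∧ altPhi a b y ≤ 1) := by
    intro y hy hy1 ⟨h1, h2⟩
    rw [altPhi_eq ha1 hb]
    have h3 : y ^ 2 / a ≤ y / 3 := by
      rw [div_le_div_iff₀ (by positivity) (by positivity)]; nlinarith
    have h4 : 0 ≤ y ^ 2 / a := by positivity
    constructor <;> nlinarith
  have h0 : ∀ᶠ y in 𝓝 (0 : ℝ), 0 ≤ altPhi a b y ∧ altPhi a b y ≤ 2 := by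
    have := (continuous_altPhi ha1 hb).tendsto 0
    rw [altPhi_zero ha1 hb] at this
    filter_upwards [this.eventually_const_le (show (0 : ℝ) < 1 by norm_num),
      this.eventually_le_const (show (1 : ℝ) < 2 by norm_num)] with y h1 h2
    exact ⟨h1, h2⟩
  have hall : ∀ {y : ℝ}, 0 ≤ y → y ≤ 1 → 0 ≤ altPhi a b y ∧ altPhi a b y ≤ 2 := fun hy hy1 =>
    forall_unitInterval_of_step hQ h0
      (fun y hy hy1 h => ⟨(step y hy hy1 h).1, (step y hy hy1 h).2.trans (by norm_num)⟩) hy hy1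
  exact step y hy hy1 (hall (by positivity) ((div_le_self hy hQ.le).trans hy1))

theorem one_sub_le_altPhi {y : ℝ} (ha : 3 ≤ a) (hb : 1 < b) (hy : 0 ≤ y) (hy1 : y ≤ 1) :
    1 - y ≤ altPhi a b y := by
  have hQ : 1 < a * b := by nlinarith
  have := altPhi_mem (y := y / (a * b)) ha hb (by positivity) ((div_le_self hy hQ.le).trans hy1)
  rw [altPhi_eq (by linarith) hb]
  have : 0 ≤ y ^ 2 / a * altPhi a b (y / (a * b)) := mul_nonneg (by positivity) this.1
  linarith

/-- In the differentiated equation the second term lies in [0, 2/3] and the third is at most 2/27 in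
absolute value, so neither can offset the leading -1. -/
theorem deriv_altPhi_mem {y : ℝ} (ha : 3 ≤ a) (hb : 3 ≤ b) (hy : 0 ≤ y) (hy1 : y ≤ 1) :
    -2 ≤ deriv (altPhi a b) y ∧ deriv (altPhi a b) y < 0 := by
  have ha1 : 1 < a := by linarith
  have hb1 : 1 < b := by linarith
  have hQ9 : 9 ≤ a * b := by nlinarith
  have hQ : 1 < a * b := by linarith
  have step : ∀ y, 0 ≤ y → y ≤ 1 →
      (-2 ≤ deriv (altPhi a b) (y / (a * b)) ∧ deriv (altPhi a b) (y / (a * b)) ≤ 2) →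
      (-2 ≤ deriv (altPhi a b) y ∧ deriv (altPhi a b) y < 0) := by
    intro y hy hy1 ⟨h1, h2⟩
    rw [deriv_altPhi_eq ha1 hb1]
    obtain ⟨h3, h4⟩ := altPhi_mem (y := y / (a * b)) ha hb1 (by positivity)
      ((div_le_self hy hQ.le).trans hy1)
    have h5 : 2 * y / a ≤ 2 / 3 := by
      rw [div_le_div_iff₀ (by positivity) (by positivity)]; nlinarith
    have h6 : 0 ≤ 2 * y / a := by positivity
    have h7 : y ^ 2 / (a * (a * b)) ≤ 1 / 27 := by
      rw [div_le_div_iff₀ (by positivity) (by positivity)]; nlinarith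
    have h8 : 0 ≤ y ^ 2 / (a * (a * b)) := by positivity
    constructor <;> nlinarith
  have h0 : ∀ᶠ y in 𝓝 (0 : ℝ), -2 ≤ deriv (altPhi a b) y ∧ deriv (altPhi a b) y ≤ 2 := by
    have := ((contDiff_altPhi ha1 hb1 (n := 1)).continuous_deriv le_rfl).tendsto 0
    rw [deriv_altPhi_eq ha1 hb1] at this
    simp only [mul_zero, zero_div, zero_mul, ne_eq, OfNat.ofNat_ne_zero, not_false_eq_true,
      zero_pow, add_zero] at this
    filter_upwards [this.eventually_const_le (show (-2 : ℝ) < -1 by norm_num),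
      this.eventually_le_const (show (-1 : ℝ) < 2 by norm_num)] with y h1 h2
    exact ⟨h1, h2⟩
  have hall : ∀ {y : ℝ}, 0 ≤ y → y ≤ 1 →
      -2 ≤ deriv (altPhi a b) y ∧ deriv (altPhi a b) y ≤ 2 := fun hy hy1 =>
    forall_unitInterval_of_step hQ h0
      (fun y hy hy1 h => ⟨(step y hy hy1 h).1, (step y hy hy1 h).2.le.trans (by norm_num)⟩) hy hy1
  exact step y hy hy1 (hall (by positivity) ((div_le_self hy hQ.le).trans hy1))

theorem strictAntiOn_altPhi (ha : 3 ≤ a) (hb : 3 ≤ b) :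
    StrictAntiOn (altPhi a b) (Set.Icc 0 1) := by
  refine strictAntiOn_of_deriv_neg (convex_Icc 0 1)
    (continuous_altPhi (by linarith) (by linarith)).continuousOn fun x hx => ?_
  rw [interior_Icc] at hx
  exact (deriv_altPhi_mem ha hb hx.1.le hx.2.le).2

/-- The derivative φ + xφ' is at least (1 - x) - 2x, which is positive for x < 1/3. -/
theorem strictMonoOn_mul_altPhi (ha : 3 ≤ a) (hb : 3 ≤ b) :
    StrictMonoOn (fun x => x * altPhi a b x) (Set.Icc 0 (1 / 3)) := by
  have hd := differentiable_altPhi (a := a) (b := b) (by linarith) (by linarith)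
  refine strictMonoOn_of_deriv_pos (convex_Icc 0 _)
    (continuous_id.mul hd.continuous).continuousOn fun x hx => ?_
  rw [interior_Icc] at hx
  have h0 : HasDerivAt (fun x => x * altPhi a b x) _ x :=
    (hasDerivAt_id' x).mul (hd x).hasDerivAt
  rw [h0.deriv]
  have h1 := (deriv_altPhi_mem ha hb hx.1.le (by linarith [hx.2])).1
  have h2 := one_sub_le_altPhi ha (by linarith : 1 < b) hx.1.le (by linarith [hx.2])
  nlinarith [hx.1, hx.2]

/-- If two continuous functions satisfy a suitable recursive inequality, then they are ordered on
`[0, 1]`. -/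
theorem nonneg_of_step {Q : ℝ} (hQ : 1 < Q) {D : ℝ → ℝ} (hD : Continuous D) (hD0 : D 0 = 0)
    (ha : 1 < a) (step : ∀ y, 0 ≤ y → y ≤ 1 → y ^ 2 / a * D (y / Q) ≤ D y) {y : ℝ}
    (hy : 0 ≤ y) (hy1 : y ≤ 1) : 0 ≤ D y := by
  refine le_of_forall_pos_le_add fun ε hε => ?_
  have : -ε ≤ D y := by
    -- The bound -ε holds near 0 by continuity, and a step preserves it because y²/a ≤ 1.
    refine forall_unitInterval_of_step hQ (p := fun y => -ε ≤ D y) ?_ ?_ hy hy1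
    · have := hD.tendsto 0
      rw [hD0] at this
      exact this.eventually_const_le (by linarith)
    · intro y hy hy1 h
      refine le_trans ?_ (step y hy hy1)
      have h1 : y ^ 2 / a ≤ 1 := by rw [div_le_one (by positivity)]; nlinarith
      have h2 : 0 ≤ y ^ 2 / a := by positivity
      nlinarith
  linarith

/-- `altPhi` increases with the second parameter. -/
theorem altPhi_lt_altPhi_right {c x : ℝ} (ha : 3 ≤ a) (hc : 3 ≤ c) (hcb : c < b)
    (hx : 0 < x) (hxa : x ≤ a) : altPhi a c x < altPhi a b x := by
  have ha1 : 1 < a := by linarith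
  have hb1 : 1 < b := by linarith
  have hc1 : 1 < c := by linarith
  have hQ9 : 9 ≤ a * c := by nlinarith
  have hQlt : a * c < a * b := by nlinarith
  have hD := (continuous_altPhi ha1 hb1).sub (continuous_altPhi ha1 hc1)
  -- The difference splits into a change of function at one point, handled by recursion, and a
  -- change of point for one function, whose sign comes from φ decreasing on [0, 1].
  have id (y : ℝ) : altPhi a b y - altPhi a c y
      = y ^ 2 / a * ((altPhi a b (y / (a * b)) - altPhi a c (y / (a * b)))
        + (altPhi a c (y / (a * b)) - altPhi a c (y / (a * c)))) := by
    rw [altPhi_eq ha1 hb1 y, altPhi_eq ha1 hc1 y]; ring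
  have anti := strictAntiOn_altPhi ha hc
  have step : ∀ y, 0 ≤ y → y ≤ 1 →
      y ^ 2 / a * (altPhi a b (y / (a * b)) - altPhi a c (y / (a * b)))
        ≤ altPhi a b y - altPhi a c y := by
    intro y hy hy1
    rw [id y]
    have hle : y / (a * b) ≤ y / (a * c) := by gcongr
    have h1 : y / (a * c) ≤ 1 := by rw [div_le_one (by positivity)]; linarith
    have := anti.antitoneOn ⟨by positivity, hle.trans h1⟩ ⟨by positivity, h1⟩ hle
    gcongr
    linarith
  have hnn : 0 ≤ altPhi a b (x / (a * b)) - altPhi a c (x / (a * b)) := by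
    refine nonneg_of_step (Q := a * b) (by linarith) hD
      (by simp [altPhi_zero ha1 hb1, altPhi_zero ha1 hc1]) ha1 step (by positivity) ?_
    rw [div_le_one (by positivity)]; nlinarith
  have hlt : x / (a * b) < x / (a * c) := by gcongr
  have h1 : x / (a * c) ≤ 1 := by rw [div_le_one (by positivity)]; nlinarith
  have := anti ⟨by positivity, hlt.le.trans h1⟩ ⟨by positivity, h1⟩ hlt
  rw [← sub_pos, id x]
  apply mul_pos (by positivity)
  linarith

/-- `altPhi` decreases with the first parameter. -/
theorem altPhi_lt_altPhi_left {d x : ℝ} (ha : 3 ≤ a) (hb : 3 ≤ b) (had : a < d)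
    (hx : 0 < x) (hxa : x ≤ a) : altPhi d b x < altPhi a b x := by
  have ha1 : 1 < a := by linarith
  have hb1 : 1 < b := by linarith
  have hd1 : 1 < d := by linarith
  have hQ9 : 9 ≤ a * b := by nlinarith
  have hQlt : a * b < d * b := by nlinarith
  have hD := (continuous_altPhi ha1 hb1).sub (continuous_altPhi hd1 hb1)
  -- With t = y/(db), (y²/d) φ(t) = yb · tφ(t), so the second part compares tφ(t) at two points.
  -- Both are at most 1/b ≤ 1/3 when y ≤ a.
  have id (y : ℝ) : altPhi a b y - altPhi d b y
      = y ^ 2 / a * (altPhi a b (y / (a * b)) - altPhi d b (y / (a * b)))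
        + y * b * ((y / (a * b)) * altPhi d b (y / (a * b))
          - (y / (d * b)) * altPhi d b (y / (d * b))) := by
    rw [altPhi_eq ha1 hb1 y, altPhi_eq hd1 hb1 y]
    field_simp
    ring
  have mono := strictMonoOn_mul_altPhi (a := d) (b := b) (by linarith) hb
  have hb3 : ∀ y, 0 ≤ y → y ≤ a → y / (a * b) ≤ 1 / 3 := by
    intro y hy hya
    rw [div_le_div_iff₀ (by positivity) (by positivity)]
    nlinarith
  have step : ∀ y, 0 ≤ y → y ≤ 1 →
      y ^ 2 / a * (altPhi a b (y / (a * b)) - altPhi d b (y / (a * b)))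
        ≤ altPhi a b y - altPhi d b y := by
    intro y hy hy1
    rw [id y]
    have hle : y / (d * b) ≤ y / (a * b) := by gcongr
    have h1 := hb3 y hy (by linarith)
    have := mono.monotoneOn ⟨by positivity, hle.trans h1⟩ ⟨by positivity, h1⟩ hle
    have : 0 ≤ y * b * ((y / (a * b)) * altPhi d b (y / (a * b))
          - (y / (d * b)) * altPhi d b (y / (d * b))) :=
      mul_nonneg (by positivity) (sub_nonneg.2 this)
    linarith
  have hnn : 0 ≤ altPhi a b (x / (a * b)) - altPhi d b (x / (a * b)) :=
    nonneg_of_step (Q := a * b) (by linarith) hD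
      (by simp [altPhi_zero ha1 hb1, altPhi_zero hd1 hb1]) ha1 step (by positivity)
      ((hb3 x hx.le hxa).trans (by norm_num))
  have hlt : x / (d * b) < x / (a * b) := by gcongr
  have h1 := hb3 x hx.le hxa
  have := mono ⟨by positivity, hlt.le.trans h1⟩ ⟨by positivity, h1⟩ hlt
  rw [← sub_pos, id x]
  have h3 : 0 < x * b * ((x / (a * b)) * altPhi d b (x / (a * b))
          - (x / (d * b)) * altPhi d b (x / (d * b))) :=
    mul_pos (by positivity) (sub_pos.2 this)
  have h4 : 0 ≤ x ^ 2 / a * (altPhi a b (x / (a * b)) - altPhi d b (x / (a * b))) :=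
    mul_nonneg (by positivity) hnn
  linarith

end Bounds

/-! ### Recovering an entire function from its zeros -/

/-- Finitely many distinct zeros can be divided out of an entire function. -/
theorem exists_eq_prod_mul {f : ℂ → ℂ} (hf : Differentiable ℂ f) {ζ : ℕ → ℂ}
    (hζ0 : ∀ i, ζ i ≠ 0) (hinj : Function.Injective ζ) (hz : ∀ i, f (-ζ i) = 0) (n : ℕ) :
    ∃ H : ℂ → ℂ, Differentiable ℂ H ∧
      ∀ z, f z = (∏ i ∈ Finset.range n, (1 + z / ζ i)) * H z := by
  induction n with
  | zero => exact ⟨f, hf, by simp⟩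
  | succ n ih =>
    obtain ⟨H, hH, hfH⟩ := ih
    have hHn : H (-ζ n) = 0 := by
      have := hfH (-ζ n)
      rw [hz n, eq_comm, mul_eq_zero] at this
      refine this.resolve_left (Finset.prod_ne_zero_iff.2 fun i hi h => ?_)
      have h1 : ζ i = ζ n := by
        have := hζ0 i
        field_simp at h
        linear_combination h
      exact (Finset.mem_range.1 hi).ne (hinj h1)
    refine ⟨fun z => ζ n * dslope H (-ζ n) z, ?_, fun z => ?_⟩
    · refine Differentiable.const_mul (differentiableOn_univ.1 ?_) _
      exact (Complex.differentiableOn_dslope univ_mem).2 hH.differentiableOn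
    · have h1 := sub_smul_dslope H (-ζ n) z
      rw [hHn, sub_zero, smul_eq_mul] at h1
      rw [hfH z, ← h1, Finset.prod_range_succ]
      have := hζ0 n
      field_simp
      ring

/-- An entire function that is bounded by `o(|z|)` times a partial product over its zeros on
suitable circles is equal to the product over these zeros. -/
theorem hasProd_of_norm_le {f : ℂ → ℂ} (hf : Differentiable ℂ f) (h0 : f 0 = 1) {ζ : ℕ → ℝ}
    (hpos : ∀ i, 0 < ζ i) (hinj : Function.Injective ζ) (hz : ∀ i, f (-(ζ i : ℂ)) = 0)
    (hs : Summable fun i => (ζ i)⁻¹) {n : ℕ → ℕ} (hn : Tendsto n atTop atTop) {R M E : ℕ → ℝ}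
    (hR : Tendsto R atTop atTop) (hE : ∀ k, 0 < E k) (hM : ∀ k z, ‖z‖ = R k → ‖f z‖ ≤ M k)
    (hP : ∀ k z, ‖z‖ = R k → E k ≤ ‖∏ i ∈ Finset.range (n k), (1 + z / (ζ i : ℂ))‖)
    (hlim : Tendsto (fun k => M k / E k / R k) atTop (𝓝 0)) (z : ℂ) :
    HasProd (fun i => 1 + z / (ζ i : ℂ)) (f z) := by
  have hmul : Multipliable (fun i => 1 + z / (ζ i : ℂ)) := by
    refine multipliable_one_add_of_summable ?_
    refine (hs.mul_left ‖z‖).congr fun i => ?_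
    rw [norm_div, Complex.norm_of_nonneg (hpos i).le, div_eq_mul_inv]
  have hconv := hmul.hasProd.tendsto_prod_nat.comp hn
  have hRinv := hR.inv_tendsto_atTop
  have hH : ∀ᶠ k in atTop, ‖f z - ∏ i ∈ Finset.range (n k), (1 + z / (ζ i : ℂ))‖
      ≤ ‖∏ i ∈ Finset.range (n k), (1 + z / (ζ i : ℂ))‖
        * ((M k / E k / R k + (R k)⁻¹) * ‖z‖) := by
    filter_upwards [hR.eventually_gt_atTop 0, hR.eventually_gt_atTop ‖z‖] with k hRk hzk
    obtain ⟨H, hHd, hfH⟩ := exists_eq_prod_mul hf (ζ := fun i => (ζ i : ℂ))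
      (fun i => by exact_mod_cast (hpos i).ne') (Complex.ofReal_injective.comp hinj) hz (n k)
    have hH0 : H 0 = 1 := by have := hfH 0; simpa [h0] using this.symm
    have hsph : ∀ w ∈ frontier (Metric.ball (0 : ℂ) (R k)), ‖H w‖ ≤ M k / E k := by
      intro w hw
      rw [frontier_ball _ hRk.ne', mem_sphere_zero_iff_norm] at hw
      have h1 := hM k w hw
      have h2 := hP k w hw
      rw [hfH w, norm_mul] at h1
      rw [le_div_iff₀ (hE k)]
      refine le_trans ?_ h1
      rw [mul_comm]
      gcongr
    have hball : ∀ w ∈ Metric.ball (0 : ℂ) (R k), ‖H w‖ ≤ M k / E k := fun w hw =>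
      Complex.norm_le_of_forall_mem_frontier_norm_le Metric.isBounded_ball
        hHd.diffContOnCl hsph (subset_closure hw)
    -- By the maximum principle the quotient H stays bounded on the disc. The Schwarz lemma around
    -- H(0) = 1 then gains the factor |z|/R, so M/E only has to be o(R).
    have hmaps : Set.MapsTo H (Metric.ball 0 (R k)) (Metric.closedBall (H 0) (M k / E k + 1)) := by
      intro w hw
      rw [hH0, mem_closedBall_iff_norm]
      refine (norm_sub_le _ _).trans ?_
      simpa using hball w hw
    have hd := Complex.dist_le_div_mul_dist_of_mapsTo_ball hHd.differentiableOn hmaps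
      (z := z) (by simpa using hzk)
    rw [hH0, dist_zero_right, dist_eq_norm] at hd
    have e : f z - ∏ i ∈ Finset.range (n k), (1 + z / (ζ i : ℂ))
        = (∏ i ∈ Finset.range (n k), (1 + z / (ζ i : ℂ))) * (H z - 1) := by rw [hfH z]; ring
    rw [e, norm_mul]
    gcongr
    refine hd.trans_eq ?_
    ring
  have hlim0 := (hconv.norm.mul ((hlim.add hRinv).mul_const ‖z‖))
  simp only [add_zero, zero_mul, mul_zero] at hlim0
  have h1 := squeeze_zero_norm' hH hlim0
  have h2 := h1.add hconv
  simp only [Function.comp_apply, sub_add_cancel, zero_add] at h2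
  have h3 : f z = ∏' i, (1 + z / (ζ i : ℂ)) := tendsto_nhds_unique tendsto_const_nhds h2
  rw [h3]
  exact hmul.hasProd

/-! ### Signs along geometric progressions and growth on circles -/

section Criterion

variable {a b : ℝ}

theorem altPhi_mul (ha : 1 < a) (hb : 1 < b) (y : ℝ) :
    altPhi a b (a * b * y) = 1 - a * b * y + a * b ^ 2 * y ^ 2 * altPhi a b y := by
  rw [altPhi_eq ha hb, mul_div_cancel_left₀ _ (by nlinarith)]
  field_simp

/-- In φ(Qy) = 1 - Qy + ab²y²φ(y), both 1 - Qy and the last term are negative. -/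
theorem altPhi_pow_mul_neg {x : ℝ} (ha : 1 < a) (hb : 1 < b) (hx1 : 1 < x)
    (hx : altPhi a b x < 0) (k : ℕ) : altPhi a b ((a * b) ^ k * x) < 0 := by
  have hQ : 1 < a * b := by nlinarith
  induction k with
  | zero => simpa using hx
  | succ k ih =>
    have h1 : 1 ≤ (a * b) ^ k := one_le_pow₀ hQ.le
    rw [pow_succ', mul_assoc, altPhi_mul ha hb]
    have h2 : a * b ^ 2 * ((a * b) ^ k * x) ^ 2 * altPhi a b ((a * b) ^ k * x) < 0 :=
      mul_neg_of_pos_of_neg (by positivity) ih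
    have h3 : 1 < (a * b) ^ k * x := by nlinarith
    nlinarith

/-- Positivity alone need not pass from y to Qy. The condition byφ(y) > 2 does: it makes the last
term of φ(Qy) at least 2Qy, hence φ(Qy) ≥ 1 + Qy. -/
theorem altPhi_pow_mul_pos {y : ℝ} (ha : 1 < a) (hb : 2 < b) (hy1 : 1 ≤ y)
    (hy : 2 < b * y * altPhi a b y) (k : ℕ) : 0 < altPhi a b ((a * b) ^ k * y) := by
  have hQ : 1 < a * b := by nlinarith
  have key : 2 < b * ((a * b) ^ k * y) * altPhi a b ((a * b) ^ k * y) := by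
    induction k with
    | zero => simpa using hy
    | succ k ih =>
      have h1 : 1 ≤ (a * b) ^ k := one_le_pow₀ hQ.le
      rw [pow_succ', mul_assoc (a * b), altPhi_mul ha (by linarith)]
      set t := (a * b) ^ k * y with ht
      have ht1 : 1 ≤ t := by nlinarith
      have h2 : 1 + a * b * t ≤ 1 - a * b * t + a * b ^ 2 * t ^ 2 * altPhi a b t := by
        have : a * b * t * 2 ≤ a * b * t * (b * t * altPhi a b t) := by gcongr
        nlinarith
      have h3 : 1 ≤ a * b * t := by nlinarith
      calc 2 < b * (1 * (1 + 1)) := by linarith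
        _ ≤ b * (a * b * t * (1 + a * b * t)) := by gcongr
        _ ≤ _ := by rw [← mul_assoc]; gcongr
  exact pos_of_mul_pos_right (lt_trans (by norm_num) key) (by positivity)

/-- With s = √b, two uses of the functional equation and φ(y) ≥ 1 - y give φ(as) ≥ 2 + as(s - 2) -
1/(as³). Only s < 2 is delicate; there a ≤ b = s² bounds the loss by s³(2 - s). -/
theorem two_lt_mul_altPhi (ha : 3 ≤ a) (hab : a ≤ b) :
    2 < b * (a * √b) * altPhi a b (a * √b) := by
  have hb : 3 ≤ b := ha.trans hab
  obtain ⟨s, hs, hs0, rfl⟩ : ∃ s : ℝ, √b = s ∧ 0 < s ∧ b = s ^ 2 :=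
    ⟨√b, rfl, by positivity, (Real.sq_sqrt (by linarith)).symm⟩
  rw [hs]
  have ha1 : 1 < a := by linarith
  have hb1 : 1 < s ^ 2 := by linarith
  have hs17 : 1.7 < s := by nlinarith
  have e1 : a * s / (a * s ^ 2) = 1 / s := by field_simp
  have h0 : 1 / s / (a * s ^ 2) ≤ 1 := by
    have : 3 * 3 * 1.7 ≤ a * s ^ 2 * s := by gcongr
    rw [div_le_one (by positivity), div_le_iff₀ hs0]
    nlinarith [mul_pos hs0 hs0]
  have h1 := one_sub_le_altPhi (y := 1 / s / (a * s ^ 2)) ha hb1 (by positivity) h0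
  have h2 : 1 - 1 / s + (1 / s) ^ 2 / a * (1 - 1 / s / (a * s ^ 2)) ≤ altPhi a (s ^ 2) (1 / s) := by
    rw [altPhi_eq ha1 hb1 (1 / s)]; gcongr
  have h3 : 2 - 2 * (a * s) + a * s ^ 2 - 1 / (a * s ^ 3) ≤ altPhi a (s ^ 2) (a * s) := by
    rw [altPhi_eq ha1 hb1 (a * s), e1]
    calc _ = 1 - a * s + (a * s) ^ 2 / a *
          (1 - 1 / s + (1 / s) ^ 2 / a * (1 - 1 / s / (a * s ^ 2))) := by
            field_simp; ring
      _ ≤ _ := by gcongr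
  have hs3 : 4.9 ≤ s ^ 3 := by
    have : (1.7 : ℝ) ^ 3 ≤ s ^ 3 := by gcongr
    norm_num at this ⊢; linarith
  have has : 14.7 ≤ a * s ^ 3 := by nlinarith
  have h4 : 1 / (a * s ^ 3) ≤ 1 / 14 := by
    apply one_div_le_one_div_of_le (by norm_num); linarith
  have h5 : -1.5 ≤ -2 * (a * s) + a * s ^ 2 := by
    rcases le_total 2 s with h | h
    · have : 0 ≤ a * s * (s - 2) := mul_nonneg (by positivity) (by linarith)
      nlinarith
    · have h6 : s ^ 2 * (s * (2 - s)) ≥ a * (s * (2 - s)) := by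
        have : 0 ≤ s * (2 - s) := mul_nonneg hs0.le (by linarith)
        gcongr
      -- s³(2 - s) decreases for s ≥ 3/2 and is about 1.474 at 1.7, a lower bound for √3.
      have h7 : s ^ 3 * (2 - s) ≤ 1.5 := by
        have : 0 ≤ (s - 1.7) := by linarith
        nlinarith [mul_nonneg this (mul_nonneg this this), mul_nonneg this this,
          mul_nonneg this hs0.le, mul_nonneg (mul_nonneg this this) (mul_nonneg this this)]
      nlinarith
  have h8 : 0.4 ≤ altPhi a (s ^ 2) (a * s) := by
    norm_num at h5 ⊢; linarith
  calc (2 : ℝ) < 14.7 * 0.4 := by norm_num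
    _ ≤ a * s ^ 3 * altPhi a (s ^ 2) (a * s) := by gcongr
    _ = _ := by ring

/-- From one radius R to the next, the function gains about R²/a, the product about R²/(xq), and the
radius Q. The ratio tends to xq/(aQ), which is below 1 because x ≤ a and q < Q; dividing by the
radius is essential. -/
theorem tendsto_altReal_div {p q x : ℝ} (ha : 1 < a) (hb : 1 < b) (hp : 0 < p) (hx : 0 < x)
    (hxa : x ≤ a) (hxp : x < p) (hq : 0 < q) (hqp : q < p) (hqQ : q < a * b) :
    Tendsto (fun k : ℕ => altReal a b ((a * b) ^ k * p) /
      (∏ m ∈ Finset.range (k + 1),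
        ((a * b) ^ m * p / x - 1) * ((a * b) ^ m * p / q - 1)) / ((a * b) ^ k * p))
      atTop (𝓝 0) := by
  have hQ : 1 < a * b := by nlinarith
  have hpow (k : ℕ) : 1 ≤ (a * b) ^ k := one_le_pow₀ hQ.le
  have hf (k : ℕ) : 0 < ((a * b) ^ k * p / x - 1) * ((a * b) ^ k * p / q - 1) := by
    have h1 : p ≤ (a * b) ^ k * p := le_mul_of_one_le_left hp.le (hpow k)
    apply mul_pos <;> rw [sub_pos, one_lt_div (by assumption)] <;> linarith
  have hprod (k : ℕ) : 0 < ∏ m ∈ Finset.range (k + 1),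
        ((a * b) ^ m * p / x - 1) * ((a * b) ^ m * p / q - 1) :=
    Finset.prod_pos fun m _ => hf m
  have hF (k : ℕ) : 1 ≤ altReal a b ((a * b) ^ k * p) := one_le_altReal ha hb (by positivity)
  have hR : Tendsto (fun k : ℕ => (a * b) ^ (k + 1) * p) atTop atTop :=
    ((tendsto_pow_atTop_atTop_of_one_lt hQ).atTop_mul_const hp).comp (tendsto_add_atTop_nat 1)
  have hRi : Tendsto (fun k : ℕ => ((a * b) ^ (k + 1) * p)⁻¹) atTop (𝓝 0) :=
    hR.inv_tendsto_atTop
  refine (summable_of_ratio_test_tendsto_lt_one (l := a⁻¹ / ((x⁻¹ * q⁻¹) * (a * b))) ?_ ?_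
    ?_).tendsto_atTop_zero
  · rw [div_lt_one (by positivity)]
    have : x * q < a * (a * b) := by nlinarith
    rw [← mul_inv, inv_mul_eq_div, lt_div_iff₀ (by positivity), inv_mul_lt_iff₀ (by linarith)]
    exact this
  · refine Eventually.of_forall fun k => ?_
    have := hprod k
    have := hF k
    positivity
  · have h1 : Tendsto (fun k : ℕ =>
        ((((a * b) ^ (k + 1) * p)⁻¹ ^ 2 + ((a * b) ^ (k + 1) * p)⁻¹)
          * (altReal a b ((a * b) ^ k * p))⁻¹)) atTop (𝓝 0) := by
      have h2 := (hRi.pow 2).add hRi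
      simp only [ne_eq, OfNat.ofNat_ne_zero, not_false_eq_true, zero_pow, add_zero] at h2
      refine squeeze_zero (fun k => ?_) (fun k => ?_) h2
      · have := hF k
        positivity
      · refine mul_le_of_le_one_right (by positivity) ?_
        exact inv_le_one_of_one_le₀ (hF k)
    have h3 : Tendsto (fun k : ℕ =>
        ((((a * b) ^ (k + 1) * p)⁻¹ ^ 2 + ((a * b) ^ (k + 1) * p)⁻¹)
          * (altReal a b ((a * b) ^ k * p))⁻¹ + a⁻¹) /
        ((x⁻¹ - ((a * b) ^ (k + 1) * p)⁻¹) * (q⁻¹ - ((a * b) ^ (k + 1) * p)⁻¹) * (a * b)))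
        atTop (𝓝 ((0 + a⁻¹) / ((x⁻¹ - 0) * (q⁻¹ - 0) * (a * b)))) :=
      (h1.add_const a⁻¹).div (((hRi.const_sub x⁻¹).mul (hRi.const_sub q⁻¹)).mul_const (a * b))
        (by simp only [sub_zero]; positivity)
    simp only [sub_zero, zero_add] at h3
    refine h3.congr fun k => ?_
    have hpk := hprod k
    have hpk1 := hprod (k + 1)
    have hFk := hF k
    have hFk1 := hF (k + 1)
    rw [Real.norm_of_nonneg (by positivity), Real.norm_of_nonneg (by positivity),
      Finset.prod_range_succ _ (k + 1)]
    set G := ∏ m ∈ Finset.range (k + 1),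
        ((a * b) ^ m * p / x - 1) * ((a * b) ^ m * p / q - 1) with hG
    have e := altReal_eq ha hb ((a * b) ^ (k + 1) * p)
    rw [show (a * b) ^ (k + 1) * p / (a * b) = (a * b) ^ k * p by
      rw [pow_succ]; field_simp] at e
    rw [e]
    have hfk := hf (k + 1)
    have h4 : (a * b) ^ (k + 1) * p / x - 1 ≠ 0 := (mul_ne_zero_iff.1 hfk.ne').1
    have h5 : (a * b) ^ (k + 1) * p / q - 1 ≠ 0 := (mul_ne_zero_iff.1 hfk.ne').2
    set R := (a * b) ^ (k + 1) * p with hRdef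
    have hRpos : 0 < R := by positivity
    have e6 : (a * b) ^ k * p = R / (a * b) := by rw [hRdef, pow_succ]; field_simp
    rw [e6] at hFk ⊢
    set Φ := altReal a b (R / (a * b)) with hΦ
    have hΦ0 : Φ ≠ 0 := by positivity
    have e4 : R / x - 1 = R * (x⁻¹ - R⁻¹) := by field_simp
    have e5 : R / q - 1 = R * (q⁻¹ - R⁻¹) := by field_simp
    rw [e4] at h4
    rw [e5] at h5
    have h4' := (mul_ne_zero_iff.1 h4).2
    have h5' := (mul_ne_zero_iff.1 h5).2
    rw [e4, e5]
    generalize x⁻¹ - R⁻¹ = X at *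
    generalize q⁻¹ - R⁻¹ = Y at *
    field_simp

end Criterion

/-! ### Construction of the zeros and the sufficient condition -/

/-- Interlacing two sequences of points with geometrically growing bounds. -/
theorem exists_strictMono_interlacing {Q x q r : ℝ} (hQ : 1 < Q) (hr : 0 < r) (hqr : q < r)
    (hrx : r < Q * x) {φ : ℝ → ℝ} (hneg : ∀ k : ℕ, φ (Q ^ k * x) < 0)
    (h1 : ∀ k : ℕ, ∃ z, r / Q * Q ^ k ≤ z ∧ z ≤ Q ^ k * x ∧ φ z = 0)
    (h2 : ∀ k : ℕ, ∃ z, Q ^ k * x ≤ z ∧ z ≤ Q ^ k * q ∧ φ z = 0) :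
    ∃ ζ : ℕ → ℝ, (∀ i, 0 < ζ i) ∧ StrictMono ζ ∧ (∀ i, φ (ζ i) = 0) ∧
      (∀ k, ζ (2 * k) ≤ Q ^ k * x) ∧ (∀ k, ζ (2 * k + 1) ≤ Q ^ k * q) ∧
      Summable fun i => (ζ i)⁻¹ := by
  choose u hu1 hu2 hu3 using h1
  choose v hv1 hv2 hv3 using h2
  have hQ0 : 0 < Q := by linarith
  have hx : r / Q < x := by rwa [div_lt_iff₀ hQ0, mul_comm]
  have hc : 0 < r / Q := by positivity
  have hu0 (k : ℕ) : 0 < u k := lt_of_lt_of_le (by positivity) (hu1 k)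
  have huv (k : ℕ) : u k < v k := by
    -- The two zeros could only coincide at Q^k x, where φ is negative.
    refine lt_of_le_of_ne ((hu2 k).trans (hv1 k)) fun h => ?_
    have h3 : u k = Q ^ k * x := le_antisymm (hu2 k) (h ▸ hv1 k)
    have := hneg k
    rw [← h3, hu3] at this
    exact lt_irrefl _ this
  have hvu (k : ℕ) : v k < u (k + 1) := by
    refine (hv2 k).trans_lt (lt_of_lt_of_le ?_ (hu1 (k + 1)))
    rw [pow_succ]
    have : r / Q * (Q ^ k * Q) = Q ^ k * r := by field_simp
    rw [this]
    gcongr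
  let ζ : ℕ → ℝ := fun n => if Even n then u (n / 2) else v (n / 2)
  have e0 (k : ℕ) : ζ (2 * k) = u k := by simp [ζ]
  have e1 (k : ℕ) : ζ (2 * k + 1) = v k := by
    simp only [ζ, Nat.not_even_two_mul_add_one, if_false]
    congr 1; omega
  have hall {P : ℕ → Prop} (hP0 : ∀ k, P (2 * k)) (hP1 : ∀ k, P (2 * k + 1)) (n : ℕ) : P n := by
    obtain ⟨k, rfl | rfl⟩ := n.even_or_odd'
    exacts [hP0 k, hP1 k]
  have hmono : StrictMono ζ := by
    refine strictMono_nat_of_lt_succ (hall (fun k => ?_) fun k => ?_)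
    · rw [e0, e1]; exact huv k
    · rw [e1, show 2 * k + 1 + 1 = 2 * (k + 1) by ring, e0]; exact hvu k
  have hgeo : Summable fun k : ℕ => (r / Q)⁻¹ * Q⁻¹ ^ k :=
    (summable_geometric_of_lt_one (by positivity) (inv_lt_one_of_one_lt₀ hQ)).mul_left _
  have hle {y : ℝ} {k : ℕ} (h : r / Q * Q ^ k ≤ y) : y⁻¹ ≤ (r / Q)⁻¹ * Q⁻¹ ^ k := by
    rw [inv_pow, ← mul_inv]
    exact inv_anti₀ (by positivity) h
  have hs0 : Summable fun k => (ζ (2 * k))⁻¹ :=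
    hgeo.of_nonneg_of_le (fun k => by rw [e0]; exact (inv_pos.2 (hu0 k)).le)
      fun k => by rw [e0]; exact hle (hu1 k)
  have hs1 : Summable fun k => (ζ (2 * k + 1))⁻¹ :=
    hgeo.of_nonneg_of_le (fun k => by rw [e1]; exact (inv_pos.2 ((hu0 k).trans (huv k))).le)
      fun k => by rw [e1]; exact hle ((hu1 k).trans (huv k).le)
  refine ⟨ζ, hall (fun k => ?_) fun k => ?_, hmono, hall (fun k => ?_) fun k => ?_, fun k => ?_,
    fun k => ?_, (hs0.hasSum.even_add_odd (f := fun i => (ζ i)⁻¹) hs1.hasSum).summable⟩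
  · rw [e0]; exact hu0 k
  · rw [e1]; exact (hu0 k).trans (huv k)
  · rw [e0]; exact hu3 k
  · rw [e1]; exact hv3 k
  · rw [e0]; exact hu2 k
  · rw [e1]; exact hv2 k

theorem one_sub_le_norm_one_add_div {z : ℂ} {ζ y : ℝ} (hζ : 0 < ζ) (hy : ζ ≤ y) :
    ‖z‖ / y - 1 ≤ ‖1 + z / (ζ : ℂ)‖ := by
  have h1 := norm_sub_le_norm_add (z / (ζ : ℂ)) 1
  rw [norm_div, Complex.norm_of_nonneg hζ.le, norm_one, add_comm] at h1
  have : ‖z‖ / y ≤ ‖z‖ / ζ := by gcongr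
  linarith

theorem le_norm_prod_one_add_div {Q p x q : ℝ} (hQ : 1 < Q) (hx : 0 < x) (hq : 0 < q)
    (hxp : x ≤ p) (hqp : q ≤ p) {ζ : ℕ → ℝ} (hpos : ∀ i, 0 < ζ i)
    (h0 : ∀ k, ζ (2 * k) ≤ Q ^ k * x) (h1 : ∀ k, ζ (2 * k + 1) ≤ Q ^ k * q) {k : ℕ} {z : ℂ}
    (hz : ‖z‖ = Q ^ k * p) :
    ∏ m ∈ Finset.range (k + 1), (Q ^ m * p / x - 1) * (Q ^ m * p / q - 1)
      ≤ ‖∏ i ∈ Finset.range (2 * (k + 1)), (1 + z / (ζ i : ℂ))‖ := by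
  have hQ0 : 0 < Q := by linarith
  have e : ∀ n : ℕ, ∏ i ∈ Finset.range (2 * n), (1 + z / (ζ i : ℂ))
      = ∏ m ∈ Finset.range n, (1 + z / (ζ (2 * m) : ℂ)) * (1 + z / (ζ (2 * m + 1) : ℂ)) := by
    intro n
    induction n with
    | zero => simp
    | succ n ih =>
      rw [show 2 * (n + 1) = 2 * n + 1 + 1 by ring, Finset.prod_range_succ,
        Finset.prod_range_succ, Finset.prod_range_succ, ih, mul_assoc]
  -- On |z| = Q^k p the m-th pair of zeros contributes factors with Q^(k-m), so the index has to be
  -- reversed.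
  rw [e, norm_prod, ← Finset.prod_range_reflect]
  have hge (m : ℕ) {y : ℝ} (hy : 0 < y) (hyp : y ≤ p) : 0 ≤ Q ^ m * p / y - 1 := by
    rw [sub_nonneg, one_le_div hy]
    exact hyp.trans (le_mul_of_one_le_left (hx.le.trans hxp) (one_le_pow₀ hQ.le))
  refine Finset.prod_le_prod (fun m _ => mul_nonneg (hge _ hx hxp) (hge _ hq hqp)) fun m hm => ?_
  have hmk : m ≤ k := by have := Finset.mem_range.1 hm; omega
  rw [norm_mul]
  have hkey {y : ℝ} (hy : 0 < y) : Q ^ (k + 1 - 1 - m) * p / y = ‖z‖ / (Q ^ m * y) := by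
    rw [hz, show k + 1 - 1 - m = k - m by omega, ← Nat.sub_add_cancel hmk, pow_add,
      Nat.add_sub_cancel]
    field_simp
  have hA := one_sub_le_norm_one_add_div (z := z) (hpos _) (h0 m)
  have hB := one_sub_le_norm_one_add_div (z := z) (hpos _) (h1 m)
  have hA' := hge (k + 1 - 1 - m) hx hxp
  have hB' := hge (k + 1 - 1 - m) hq hqp
  rw [← hkey hx] at hA
  rw [← hkey hq] at hB
  exact mul_le_mul hA hB hB' (norm_nonneg _)

theorem altFun_neg_ofReal (a b x : ℝ) : altFun a b (-(x : ℂ)) = (altPhi a b x : ℂ) := by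
  rw [altPhi, ← altFun_ofReal]; push_cast; rfl

theorem altFun_zero {a b : ℝ} (ha : 1 < a) (hb : 1 < b) : altFun a b 0 = 1 := by
  rw [altFun_eq ha hb]; simp

/-- A sufficient condition: a negative value of `altPhi` before the point `a`. -/
theorem laguerrePolyaI_altFun {a b x : ℝ} (ha : 3 ≤ a) (hab : a ≤ b) (hx0 : 0 < x) (hxa : x ≤ a)
    (hx : altPhi a b x < 0) : LaguerrePolyaI (altFun a b) := by
  have hb : 3 ≤ b := ha.trans hab
  have ha1 : 1 < a := by linarith
  have hb1 : 1 < b := by linarith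
  have hQ : 1 < a * b := by nlinarith
  have hx1 : 1 < x := by
    by_contra h
    exact absurd (altPhi_mem ha hb1 hx0.le (not_lt.1 h)).1 (not_le.2 hx)
  have hsq : 1 < √b := by rw [Real.lt_sqrt] <;> linarith
  have hsb : √b < b := by
    have := Real.sq_sqrt (show 0 ≤ b by linarith)
    nlinarith
  set p := a * √b with hp
  have hcont := continuous_altPhi ha1 hb1
  -- Positivity is needed at points q < p < r: the k-th pair of zeros lies below Q^k q and the next
  -- pair above Q^k r, so the circle of radius Q^k p stays clear of the chosen zeros.
  have hopen : ∀ᶠ y in 𝓝 p, a < y ∧ y < a * b ∧ 2 < b * y * altPhi a b y := by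
    refine (lt_mem_nhds (by nlinarith)).and ((gt_mem_nhds (by nlinarith)).and ?_)
    have : Continuous fun y => b * y * altPhi a b y := by fun_prop
    exact this.continuousAt.eventually (lt_mem_nhds (two_lt_mul_altPhi ha hab))
  obtain ⟨l, u, ⟨hl, hu⟩, hlu⟩ := mem_nhds_iff_exists_Ioo_subset.1 hopen
  obtain ⟨q, hlq, hqp⟩ := exists_between hl
  obtain ⟨r, hpr, hru⟩ := exists_between hu
  obtain ⟨hq1, hq2, hq3⟩ := hlu ⟨hlq, hqp.trans hu⟩
  obtain ⟨hr1, hr2, hr3⟩ := hlu ⟨hl.trans hpr, hru⟩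
  have hr0 : 0 < r := by linarith
  have hneg := altPhi_pow_mul_neg ha1 hb1 hx1 hx
  have hposq := altPhi_pow_mul_pos ha1 (by linarith) (by linarith) hq3
  have hposr := altPhi_pow_mul_pos ha1 (by linarith) (by linarith) hr3
  have hxr : r < a * b * x := by nlinarith
  have hleft (k : ℕ) : 0 ≤ altPhi a b (r / (a * b) * (a * b) ^ k) := by
    rcases k with _ | k
    · rw [pow_zero, mul_one]
      refine (altPhi_mem ha hb1 (by positivity) ?_).1
      rw [div_le_one (by positivity)]; exact hr2.le
    · rw [show r / (a * b) * (a * b) ^ (k + 1) = (a * b) ^ k * r by rw [pow_succ]; field_simp]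
      exact (hposr k).le
  obtain ⟨ζ, hζ0, hζm, hζz, hζe, hζo, hζs⟩ := exists_strictMono_interlacing
    (x := x) (q := q) (r := r) hQ (by linarith) (hqp.trans hpr) hxr hneg
    (fun k => by
      have hle : r / (a * b) * (a * b) ^ k ≤ (a * b) ^ k * x := by
        rw [mul_comm]
        gcongr
        rw [div_le_iff₀ (by linarith)]; linarith
      obtain ⟨z, hz, hz0⟩ := intermediate_value_Icc' hle hcont.continuousOn
        ⟨(hneg k).le, hleft k⟩
      exact ⟨z, hz.1, hz.2, hz0⟩)
    (fun k => by
      have hle : (a * b) ^ k * x ≤ (a * b) ^ k * q := by gcongr; linarith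
      obtain ⟨z, hz, hz0⟩ := intermediate_value_Icc hle hcont.continuousOn
        ⟨(hneg k).le, (hposq k).le⟩
      exact ⟨z, hz.1, hz.2, hz0⟩)
  have hp0 : 0 < p := by linarith
  have hqp0 : 0 < q := by linarith
  have hxp : x < p := by linarith
  have hprod (z : ℂ) : HasProd (fun i => 1 + z / (ζ i : ℂ)) (altFun a b z) := by
    refine hasProd_of_norm_le (differentiable_altFun ha1 hb1) (altFun_zero ha1 hb1) hζ0
      hζm.injective (fun i => by rw [altFun_neg_ofReal, hζz]; simp) hζs
      (n := fun k => 2 * (k + 1)) ?_ (R := fun k => (a * b) ^ k * p)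
      (M := fun k => altReal a b ((a * b) ^ k * p))
      (E := fun k => ∏ m ∈ Finset.range (k + 1),
        ((a * b) ^ m * p / x - 1) * ((a * b) ^ m * p / q - 1)) ?_ ?_ ?_ ?_ ?_ z
    · exact tendsto_atTop_mono (fun k => by show k ≤ 2 * (k + 1); omega) tendsto_id
    · exact (tendsto_pow_atTop_atTop_of_one_lt hQ).atTop_mul_const hp0
    · intro k
      refine Finset.prod_pos fun m _ => ?_
      have : p ≤ (a * b) ^ m * p := le_mul_of_one_le_left hp0.le (one_le_pow₀ hQ.le)
      apply mul_pos <;> rw [sub_pos, one_lt_div (by assumption)] <;> linarith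
    · intro k z hz
      exact norm_altFun_le ha1 hb1 (by positivity) hz.le
    · intro k z hz
      exact le_norm_prod_one_add_div hQ hx0 hqp0 hxp.le hqp.le hζ0 hζe hζo hz
    · exact tendsto_altReal_div ha1 hb1 hp0 hx0 hxa hxp hqp0 hqp hq2
  refine ⟨⟨differentiable_altFun ha1 hb1, fun y => by rw [altFun_ofReal, Complex.ofReal_im]⟩,
    1, 0, 0, Set.univ, fun k => ζ k, altFun a b, le_rfl, fun k => hζ0 k, ?_, fun z => ?_, by simp⟩
  · exact hζs.comp_injective Subtype.val_injective
  · exact ((Equiv.Set.univ ℕ).hasProd_iff (f := fun i => 1 + z / (ζ i : ℂ))).2 (hprod z)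

/-! ### Power sums of the logarithmic derivative -/

section LogDerivative

variable {ι : Type*} {y : ι → ℝ}

theorem summable_pow_succ_of_nonneg (hy : ∀ k, 0 ≤ y k) (hs : Summable y) (n : ℕ) :
    Summable fun k => y k ^ (n + 1) := by
  refine (hs.mul_left ((∑' k, y k) ^ n)).of_nonneg_of_le (fun k => by have := hy k; positivity)
    fun k => ?_
  have h1 : y k ≤ ∑' k, y k := hs.le_tsum k fun j _ => hy j
  have h2 := hy k
  rw [pow_succ]
  gcongr

theorem div_one_add_mul_le {x t : ℝ} (hx : 0 < x) (ht : 0 ≤ t) : t / (1 + x * t) ≤ t :=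
  div_le_self ht (by nlinarith [mul_nonneg hx.le ht])

theorem summable_div_one_add_pow (hy : ∀ k, 0 ≤ y k) (hs : Summable y) {x : ℝ} (hx : 0 < x)
    (n : ℕ) : Summable fun k => (y k / (1 + x * y k)) ^ (n + 1) := by
  refine (summable_pow_succ_of_nonneg hy hs n).of_nonneg_of_le (fun k => ?_) fun k => ?_
  · have := hy k
    positivity
  · have h := hy k
    have := div_one_add_mul_le hx h
    gcongr

theorem hasDerivAt_tsum_log (hy : ∀ k, 0 ≤ y k) (hs : Summable y) {x : ℝ} (hx : 0 < x) :
    HasDerivAt (fun x => ∑' k, Real.log (1 + x * y k)) (∑' k, y k / (1 + x * y k)) x := by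
  refine hasDerivAt_tsum_of_isPreconnected (g := fun k x => Real.log (1 + x * y k))
    (g' := fun k x => y k / (1 + x * y k)) (t := Set.Ioi 0) (y₀ := x) hs isOpen_Ioi
    isPreconnected_Ioi (fun k w hw => ?_) (fun k w hw => ?_) hx
    (Real.summable_log_one_add_of_summable (hs.mul_left x)) hx
  · have h1 : 0 < 1 + w * y k := by have := hy k; have : 0 < w := hw; positivity
    have h2 : HasDerivAt (fun w => 1 + w * y k) (y k) w := by
      simpa using ((hasDerivAt_id' w).mul_const (y k)).const_add 1
    exact h2.log h1.ne'
  · have h1 := hy k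
    have h2 : 0 < w := hw
    rw [Real.norm_of_nonneg (by positivity)]
    exact div_one_add_mul_le h2 h1

theorem hasDerivAt_tsum_div_pow (hy : ∀ k, 0 ≤ y k) (hs : Summable y) (n : ℕ) {x : ℝ}
    (hx : 0 < x) :
    HasDerivAt (fun x => ∑' k, (y k / (1 + x * y k)) ^ (n + 1))
      (-(n + 1) * ∑' k, (y k / (1 + x * y k)) ^ (n + 2)) x := by
  rw [← tsum_mul_left]
  refine hasDerivAt_tsum_of_isPreconnected (g := fun k x => (y k / (1 + x * y k)) ^ (n + 1))
    (g' := fun k x => -(n + 1 : ℝ) * (y k / (1 + x * y k)) ^ (n + 2)) (t := Set.Ioi 0) (y₀ := x)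
    (u := fun k => (n + 1) * y k ^ (n + 2))
    ((summable_pow_succ_of_nonneg hy hs (n + 1)).mul_left _) isOpen_Ioi
    isPreconnected_Ioi (fun k w hw => ?_) (fun k w hw => ?_) hx
    (summable_div_one_add_pow hy hs hx n) hx
  · have h1 : 0 < 1 + w * y k := by have := hy k; have : 0 < w := hw; positivity
    have h2 : HasDerivAt (fun w => 1 + w * y k) (y k) w := by
      simpa using ((hasDerivAt_id' w).mul_const (y k)).const_add 1
    have h3 : HasDerivAt (fun w => (y k / (1 + w * y k)) ^ (n + 1)) _ w :=
      ((hasDerivAt_const w (y k)).div h2 h1.ne').pow (n + 1)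
    refine h3.congr_deriv ?_
    simp only [Nat.add_sub_cancel, Pi.div_apply]
    push_cast
    rw [div_pow, div_pow]
    field_simp
    ring
  · have h1 := hy k
    have h2 : 0 < w := hw
    have h3 : (n + 1 : ℝ) = ‖-(n + 1 : ℝ)‖ := by
      rw [norm_neg, Real.norm_of_nonneg (by positivity)]
    rw [norm_mul, ← h3, Real.norm_of_nonneg (by positivity)]
    have := div_one_add_mul_le h2 h1
    gcongr

/-- Cauchy--Schwarz for the power sums of the logarithmic derivative. -/
theorem tsum_sq_sq_le (hy : ∀ k, 0 ≤ y k) (h1 : Summable y) (h2 : Summable fun k => y k ^ 2)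
    (h3 : Summable fun k => y k ^ 3) :
    (∑' k, y k ^ 2) ^ 2 ≤ (∑' k, y k) * ∑' k, y k ^ 3 := by
  refine le_of_tendsto_of_tendsto' (h2.hasSum.pow 2) (Tendsto.mul h1.hasSum h3.hasSum) fun s => ?_
  refine Finset.sum_sq_le_sum_mul_sum_of_sq_le_mul s (fun i _ => hy i)
    (fun i _ => pow_nonneg (hy i) 3) fun i _ => le_of_eq (by ring)

/-- Differential inequalities for a function `exp (β x) ∏ (1 + x y_k)` on the positive half-line. -/
theorem deriv_inequalities {F : ℝ → ℝ} {β : ℝ} (hβ : 0 ≤ β) (hy : ∀ k, 0 ≤ y k)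
    (hs : Summable y)
    (hF : ∀ x, 0 < x → F x = Real.exp (β * x + ∑' k, Real.log (1 + x * y k)))
    {x : ℝ} (hx : 0 < x) :
    2 * (deriv F x ^ 2 - F x * deriv (deriv F) x) ^ 2 ≤
      deriv F x * (F x ^ 2 * deriv (deriv (deriv F)) x - F x * deriv F x * deriv (deriv F) x
        + 2 * deriv F x * (deriv F x ^ 2 - F x * deriv (deriv F) x)) ∧
    ∀ Y, 0 ≤ Y → (∀ k, y k ≤ Y) → deriv F x ^ 2 - F x * deriv (deriv F) x ≤ Y * (F x * deriv F x) := by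
  -- (log F)' = β + S 1 and (S n)' = -n S (n + 1), so the derivatives of F are polynomials in F, β
  -- and the S n.
  set S : ℕ → ℝ → ℝ := fun n x => ∑' k, (y k / (1 + x * y k)) ^ n with hS
  have hS1 (x : ℝ) : S 1 x = ∑' k, y k / (1 + x * y k) := by simp [hS]
  have dS (n : ℕ) {x : ℝ} (hx : 0 < x) :
      HasDerivAt (S (n + 1)) (-(n + 1) * S (n + 2) x) x := hasDerivAt_tsum_div_pow hy hs n hx
  have d1 : ∀ x, 0 < x → HasDerivAt F (F x * (β + S 1 x)) x := by
    intro x hx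
    have h1 : HasDerivAt (fun x => Real.exp (β * x + ∑' k, Real.log (1 + x * y k)))
        (Real.exp (β * x + ∑' k, Real.log (1 + x * y k)) * (β * 1 + S 1 x)) x := by
      rw [hS1]
      exact (((hasDerivAt_id' x).const_mul β).add (hasDerivAt_tsum_log hy hs hx)).exp
    rw [← hF x hx, mul_one] at h1
    refine h1.congr_of_eventuallyEq ?_
    filter_upwards [lt_mem_nhds hx] with z hz using hF z hz
  have e1 : ∀ x, 0 < x → deriv F x = F x * (β + S 1 x) := fun x hx => (d1 x hx).deriv
  have d2 : ∀ x, 0 < x → HasDerivAt (deriv F) (deriv F x * (β + S 1 x) - F x * S 2 x) x := by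
    intro x hx
    have h1 : HasDerivAt (fun x => F x * (β + S 1 x)) _ x := (d1 x hx).mul ((dS 0 hx).const_add β)
    rw [← e1 x hx] at h1
    refine (h1.congr_of_eventuallyEq ?_).congr_deriv (by push_cast; ring)
    filter_upwards [lt_mem_nhds hx] with z hz using e1 z hz
  have e2 : ∀ x, 0 < x → deriv (deriv F) x = deriv F x * (β + S 1 x) - F x * S 2 x :=
    fun x hx => (d2 x hx).deriv
  have d3 : HasDerivAt (deriv (deriv F)) (deriv (deriv F) x * (β + S 1 x)
      - 2 * deriv F x * S 2 x + 2 * F x * S 3 x) x := by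
    have h1 : HasDerivAt (fun x => deriv F x * (β + S 1 x) - F x * S 2 x) _ x :=
      ((d2 x hx).mul ((dS 0 hx).const_add β)).sub ((d1 x hx).mul (dS 1 hx))
    rw [← e2 x hx, ← e1 x hx] at h1
    refine (h1.congr_of_eventuallyEq ?_).congr_deriv (by push_cast; ring)
    filter_upwards [lt_mem_nhds hx] with z hz using e2 z hz
  have hw (k : ι) : 0 ≤ y k / (1 + x * y k) := by have := hy k; positivity
  have hsum (n : ℕ) := summable_div_one_add_pow hy hs hx n
  have hsum1 : Summable fun k => y k / (1 + x * y k) := by simpa using hsum 0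
  have cs : S 2 x ^ 2 ≤ S 1 x * S 3 x := by
    rw [hS1]
    exact tsum_sq_sq_le hw hsum1 (hsum 1) (hsum 2)
  have hS3 : 0 ≤ S 3 x := tsum_nonneg fun k => pow_nonneg (hw k) 3
  have hFx : 0 < F x := by rw [hF x hx]; positivity
  -- As β and S 3 are nonnegative, adding β keeps the Cauchy–Schwarz bound.
  have cs' : S 2 x ^ 2 ≤ (β + S 1 x) * S 3 x := by nlinarith
  have hA : deriv F x ^ 2 - F x * deriv (deriv F) x = F x ^ 2 * S 2 x := by
    rw [e2 x hx, e1 x hx]; ring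
  rw [hA]
  constructor
  · rw [d3.deriv]
    have : 2 * (F x ^ 2 * S 2 x) ^ 2 ≤ 2 * F x ^ 4 * ((β + S 1 x) * S 3 x) := by
      calc _ = 2 * F x ^ 4 * S 2 x ^ 2 := by ring
        _ ≤ _ := by gcongr
    refine this.trans_eq ?_
    rw [e2 x hx, e1 x hx]
    ring
  · intro Y hY0 hY
    have h1 : S 2 x ≤ Y * S 1 x := by
      rw [hS1, ← tsum_mul_left]
      refine (hsum 1).tsum_le_tsum (fun k => ?_) (hsum1.mul_left Y)
      rw [pow_two]
      exact mul_le_mul_of_nonneg_right ((div_one_add_mul_le hx (hy k)).trans (hY k)) (hw k)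
    have h2 : S 2 x ≤ Y * (β + S 1 x) := by
      have := mul_nonneg hY0 hβ
      linarith
    rw [e1 x hx]
    calc F x ^ 2 * S 2 x ≤ F x ^ 2 * (Y * (β + S 1 x)) := by gcongr
      _ = _ := by ring

end LogDerivative

/-! ### Derivatives at the origin -/

section ValuesAtZero

variable {a b : ℝ}

theorem deriv_altReal_eq (ha : 1 < a) (hb : 1 < b) :
    deriv (altReal a b) = fun x => 1 + 2 * x / a * altReal a b (x / (a * b))
      + x ^ 2 / (a * (a * b)) * deriv (altReal a b) (x / (a * b)) := by
  funext x
  have hd : Differentiable ℝ (altReal a b) := (contDiff_altReal ha hb (n := 1)).differentiable (by simp)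
  have h2 : HasDerivAt (fun x : ℝ => altReal a b (x / (a * b)))
      (deriv (altReal a b) (x / (a * b)) * (1 / (a * b))) x :=
    HasDerivAt.comp (h₂ := altReal a b) x (hd _).hasDerivAt ((hasDerivAt_id x).div_const (a * b))
  have h3 : HasDerivAt (fun x : ℝ => 1 + x + x ^ 2 / a * altReal a b (x / (a * b))) _ x :=
    ((hasDerivAt_id' x).const_add 1).add (((hasDerivAt_pow 2 x).div_const a).mul h2)
  have h4 : altReal a b = fun x : ℝ => 1 + x + x ^ 2 / a * altReal a b (x / (a * b)) :=
    funext (altReal_eq ha hb)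
  rw [← h4] at h3
  rw [h3.deriv]
  have : a ≠ 0 := by linarith
  have : b ≠ 0 := by linarith
  simp only [Nat.cast_ofNat, Nat.add_one_sub_one, pow_one]
  field_simp
  ring

theorem deriv_deriv_altReal_eq (ha : 1 < a) (hb : 1 < b) :
    deriv (deriv (altReal a b)) = fun x => 2 / a * altReal a b (x / (a * b))
      + 4 * x / (a * (a * b)) * deriv (altReal a b) (x / (a * b))
      + x ^ 2 / (a * (a * b) ^ 2) * deriv (deriv (altReal a b)) (x / (a * b)) := by
  funext x
  have hc : ContDiff ℝ 2 (altReal a b) := contDiff_altReal ha hb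
  have hd : Differentiable ℝ (altReal a b) := hc.differentiable (by simp)
  have hd' : Differentiable ℝ (deriv (altReal a b)) :=
    hc.differentiable_deriv_two
  have h1 := (hasDerivAt_id x).div_const (a * b)
  have h2 : HasDerivAt (fun x : ℝ => altReal a b (x / (a * b)))
      (deriv (altReal a b) (x / (a * b)) * (1 / (a * b))) x :=
    HasDerivAt.comp (h₂ := altReal a b) x (hd _).hasDerivAt h1
  have h2' : HasDerivAt (fun x : ℝ => deriv (altReal a b) (x / (a * b)))
      (deriv (deriv (altReal a b)) (x / (a * b)) * (1 / (a * b))) x :=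
    HasDerivAt.comp (h₂ := deriv (altReal a b)) x (hd' _).hasDerivAt h1
  have h3 : HasDerivAt (fun x => 1 + 2 * x / a * altReal a b (x / (a * b))
      + x ^ 2 / (a * (a * b)) * deriv (altReal a b) (x / (a * b))) _ x :=
    (((((hasDerivAt_id' x).const_mul 2).div_const a).mul h2).const_add 1).add
      (((hasDerivAt_pow 2 x).div_const (a * (a * b))).mul h2')
  rw [← deriv_altReal_eq ha hb] at h3
  rw [h3.deriv]
  have : a ≠ 0 := by linarith
  have : b ≠ 0 := by linarith
  simp only [Nat.cast_ofNat, Nat.add_one_sub_one, pow_one]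
  field_simp
  ring

theorem deriv_altReal_zero (ha : 1 < a) (hb : 1 < b) : deriv (altReal a b) 0 = 1 := by
  rw [deriv_altReal_eq ha hb]; simp

theorem deriv_deriv_altReal_zero (ha : 1 < a) (hb : 1 < b) :
    deriv (deriv (altReal a b)) 0 = 2 / a := by
  rw [deriv_deriv_altReal_eq ha hb]; simp [altReal_zero ha hb]

theorem deriv_deriv_deriv_altReal_zero (ha : 1 < a) (hb : 1 < b) :
    deriv (deriv (deriv (altReal a b))) 0 = 6 / (a ^ 2 * b) := by
  have hc : ContDiff ℝ 3 (altReal a b) := contDiff_altReal ha hb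
  have hc' : ContDiff ℝ 2 (deriv (altReal a b)) := hc.deriv'
  have hd : Differentiable ℝ (altReal a b) := hc.differentiable (by simp)
  have hd' : Differentiable ℝ (deriv (altReal a b)) := hc'.differentiable (by simp)
  have hd'' : Differentiable ℝ (deriv (deriv (altReal a b))) := hc'.differentiable_deriv_two
  have h1 := (hasDerivAt_id (0 : ℝ)).div_const (a * b)
  have comp {g : ℝ → ℝ} (hg : Differentiable ℝ g) :
      HasDerivAt (fun x : ℝ => g (x / (a * b))) (deriv g (0 / (a * b)) * (1 / (a * b))) 0 :=
    HasDerivAt.comp (h₂ := g) 0 (hg _).hasDerivAt h1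
  have h3 : HasDerivAt (fun x => 2 / a * altReal a b (x / (a * b))
      + 4 * x / (a * (a * b)) * deriv (altReal a b) (x / (a * b))
      + x ^ 2 / (a * (a * b) ^ 2) * deriv (deriv (altReal a b)) (x / (a * b))) _ 0 :=
    (((comp hd).const_mul (2 / a)).add
      ((((hasDerivAt_id' (0 : ℝ)).const_mul 4).div_const (a * (a * b))).mul (comp hd'))).add
      (((hasDerivAt_pow 2 (0 : ℝ)).div_const (a * (a * b) ^ 2)).mul (comp hd''))
  rw [← deriv_deriv_altReal_eq ha hb] at h3
  rw [h3.deriv]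
  simp only [zero_div, deriv_altReal_zero ha hb]
  have : a ≠ 0 := by linarith
  have : b ≠ 0 := by linarith
  field_simp
  ring

end ValuesAtZero

/-! ### Passing between the two Laguerre–Pólya classes -/

theorem nonneg_of_le_mul_exp {δ C m : ℝ} (hδ : 0 < δ)
    (h : ∀ᶠ x in atTop, δ ≤ C * Real.exp (m * x)) : 0 ≤ m := by
  by_contra! hm
  have h1 : Tendsto (fun x => C * Real.exp (m * x)) atTop (𝓝 (C * 0)) :=
    (Real.tendsto_exp_atBot.comp (tendsto_id.const_mul_atTop_of_neg hm)).const_mul C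
  rw [mul_zero] at h1
  obtain ⟨x, hx1, hx2⟩ := (h.and (h1.eventually (gt_mem_nhds hδ))).exists
  linarith

theorem LaguerrePolyaI.laguerrePolya {f : ℂ → ℂ} (hf : LaguerrePolyaI f) : LaguerrePolya f := by
  obtain ⟨hr, c, β, n, S, x, P, hβ, hx, hs, hP, hfe⟩ := hf
  refine ⟨hr, c, 0, β + ∑' k, (x k)⁻¹, n, S, fun k => -x k,
    fun z => P z * Complex.exp (-z * ((∑' k, (x k)⁻¹ : ℝ) : ℂ)), le_rfl,
    fun k => neg_ne_zero.2 (hx k).ne', ?_, fun z => ?_, fun z => ?_⟩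
  · simpa using summable_pow_succ_of_nonneg (fun k => (inv_pos.2 (hx k)).le) hs 1
  · have h1 : HasSum (fun k => -z * (((x k)⁻¹ : ℝ) : ℂ)) (-z * ((∑' k, (x k)⁻¹ : ℝ) : ℂ)) :=
      (Complex.hasSum_ofReal.2 hs.hasSum).mul_left (-z)
    convert (hP z).mul h1.cexp using 2 with k
    simp only [Function.comp_apply]
    push_cast
    congr 1
    · ring
    · congr 1; rw [div_neg]; ring
  · have : Complex.exp (β * z) = Complex.exp (-((0 : ℝ) : ℂ) * z ^ 2 +
        ((β + ∑' k, (x k)⁻¹ : ℝ) : ℂ) * z) * Complex.exp (-z * ((∑' k, (x k)⁻¹ : ℝ) : ℂ)) := by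
      rw [← Complex.exp_add]
      congr 1
      push_cast
      ring
    rw [hfe z, this]
    ring

theorem LaguerrePolyaI.const_mul_comp_mul {f : ℂ → ℂ} (hf : LaguerrePolyaI f) (d : ℝ) {l : ℝ}
    (hl : 0 < l) : LaguerrePolyaI fun z => d * f (l * z) := by
  obtain ⟨⟨hd, hr⟩, c, β, n, S, x, P, hβ, hx, hs, hP, hfe⟩ := hf
  refine ⟨⟨by fun_prop, fun y => ?_⟩, d * c * l ^ n, β * l, n, S, fun k => x k / l,
    fun z => P (l * z), by positivity, fun k => div_pos (hx k) hl, ?_, fun z => ?_, fun z => ?_⟩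
  · have := hr (l * y)
    push_cast at this
    simp [this]
  · refine (hs.mul_left l).congr fun k => ?_
    rw [inv_div, div_eq_mul_inv]
  · convert hP (l * z) using 2 with k
    push_cast
    rw [div_div_eq_mul_div, mul_comm]
  · simp only [hfe]
    push_cast
    rw [mul_pow, show (β : ℂ) * l * z = β * (l * z) by ring]
    ring

/-- A linear factor costs an arbitrarily small exponential rate t, at the price of the constant 1/t.
-/
theorem one_add_le_inv_mul_exp {t s : ℝ} (ht : 0 < t) (ht1 : t ≤ 1) :
    1 + s ≤ t⁻¹ * Real.exp (t * s) := by
  rw [inv_mul_eq_div, le_div_iff₀ ht]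
  have := Real.add_one_le_exp (t * s)
  linarith

/-- A function of the Laguerre--Pólya class that is bounded away from zero on the positive half-line
is of type I. -/
theorem LaguerrePolya.laguerrePolyaI {f : ℂ → ℂ} (hf : LaguerrePolya f) {δ : ℝ} (hδ : 0 < δ)
    (hfδ : ∀ x : ℝ, 0 ≤ x → δ ≤ ‖f x‖) : LaguerrePolyaI f := by
  obtain ⟨hr, c, α, β, n, S, x, P, hα, hx, -, hP, hfe⟩ := hf
  have hxneg : ∀ k, x k < 0 := by
    intro k
    refine lt_of_le_of_ne (not_lt.1 fun h => ?_) (hx k)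
    have h1 : P (x k) = 0 := (hP (x k)).unique
      (hasProd_zero_of_exists_eq_zero ⟨k, by
        have : (x k : ℂ) ≠ 0 := by exact_mod_cast hx k
        simp [div_self this]⟩)
    have h2 := hfδ (x k) h.le
    rw [hfe, h1, mul_zero, norm_zero] at h2
    linarith
  have hn : n = 0 := by
    by_contra hn
    have h2 := hfδ 0 le_rfl
    rw [hfe, Complex.ofReal_zero, zero_pow hn] at h2
    simp at h2
    linarith
  subst hn
  set y : S → ℝ := fun k => -(x k)⁻¹ with hy
  have hy0 (k : S) : 0 < y k := by simpa [hy] using hxneg k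
  have hnorm (t : ℝ) (ht : 0 ≤ t) :
      HasProd (fun k => (1 + t * y k) * Real.exp (-(t * y k))) ‖P t‖ := by
    refine (hP t).norm.congr fun s => Finset.prod_congr rfl fun k _ => ?_
    have h1 : (1 - (t : ℂ) / x k) * Complex.exp ((t : ℂ) / x k)
        = (((1 + t * y k) * Real.exp (-(t * y k)) : ℝ) : ℂ) := by
      simp only [hy]
      push_cast
      congr 1
      · rw [div_eq_mul_inv]; ring
      · congr 1; rw [div_eq_mul_inv]; ring
    have := (hy0 k).le
    beta_reduce
    rw [h1, Complex.norm_of_nonneg (by positivity)]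
  have hfac (t : ℝ) (ht : 0 ≤ t) (k : S) :
      0 ≤ (1 + t * y k) * Real.exp (-(t * y k)) ∧ (1 + t * y k) * Real.exp (-(t * y k)) ≤ 1 := by
    have := (hy0 k).le
    refine ⟨by positivity, ?_⟩
    rw [Real.exp_neg, ← div_eq_mul_inv, div_le_one (Real.exp_pos _), add_comm]
    exact Real.add_one_le_exp _
  -- All factors (1 + ty)e^{-ty} lie in [0, 1], so the full product is at most any finite
  -- subproduct.
  have hPle (t : ℝ) (ht : 0 ≤ t) (s : Finset S) :
      ‖P t‖ ≤ ∏ k ∈ s, (1 + t * y k) * Real.exp (-(t * y k)) := by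
    refine le_of_tendsto (hnorm t ht) ?_
    filter_upwards [eventually_ge_atTop s] with u hu
    rw [← Finset.prod_sdiff hu]
    exact mul_le_of_le_one_left (Finset.prod_nonneg fun k _ => (hfac t ht k).1)
      (Finset.prod_le_one (fun k _ => (hfac t ht k).1) fun k _ => (hfac t ht k).2)
  have hmain (t : ℝ) (ht : 0 ≤ t) (s : Finset S) : δ ≤ |c| * Real.exp (-α * t ^ 2 + β * t) *
      ∏ k ∈ s, (1 + t * y k) * Real.exp (-(t * y k)) := by
    refine (hfδ t ht).trans ?_
    rw [hfe, pow_zero, mul_one, norm_mul, norm_mul, Complex.norm_real, Real.norm_eq_abs,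
      show -(α : ℂ) * (t : ℂ) ^ 2 + (β : ℂ) * t = ((-α * t ^ 2 + β * t : ℝ) : ℂ) by push_cast; rfl,
      Complex.norm_exp_ofReal]
    gcongr
    exact hPle t ht s
  have hα0 : α = 0 := by
    by_contra h
    have hαpos : 0 < α := lt_of_le_of_ne hα (Ne.symm h)
    have : (0 : ℝ) ≤ -1 := by
      refine nonneg_of_le_mul_exp (C := |c|) hδ ?_
      filter_upwards [eventually_ge_atTop 0, eventually_ge_atTop ((β + 1) / α)] with t ht ht1
      have h1 := hmain t ht ∅
      rw [Finset.prod_empty, mul_one] at h1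
      refine h1.trans ?_
      rw [div_le_iff₀ hαpos] at ht1
      gcongr
      nlinarith
    linarith
  subst hα0
  -- Boundedness away from 0 as t → ∞ forces the exponential rate β - (1 - τ)∑ y_k to be nonnegative
  -- for each τ in (0, 1]; then τ → 0.
  have hsum (s : Finset S) : ∑ k ∈ s, y k ≤ β := by
    have h1 : ∀ τ : ℝ, 0 < τ → τ ≤ 1 → 0 ≤ β - (1 - τ) * ∑ k ∈ s, y k := by
      intro τ hτ hτ1
      refine nonneg_of_le_mul_exp (C := |c| * τ⁻¹ ^ s.card) hδ ?_
      filter_upwards [eventually_ge_atTop 0] with t ht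
      refine (hmain t ht s).trans ?_
      have h2 : ∏ k ∈ s, (1 + t * y k) * Real.exp (-(t * y k))
          ≤ ∏ k ∈ s, τ⁻¹ * Real.exp (-(1 - τ) * t * y k) := by
        refine Finset.prod_le_prod (fun k _ => (hfac t ht k).1) fun k _ => ?_
        have := (hy0 k).le
        have h3 := one_add_le_inv_mul_exp (s := t * y k) hτ hτ1
        calc _ ≤ τ⁻¹ * Real.exp (τ * (t * y k)) * Real.exp (-(t * y k)) := by gcongr
          _ = _ := by rw [mul_assoc, ← Real.exp_add]; congr 2; ring
      calc _ ≤ |c| * Real.exp (-0 * t ^ 2 + β * t)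
            * ∏ k ∈ s, τ⁻¹ * Real.exp (-(1 - τ) * t * y k) := by gcongr
        _ = _ := by
          rw [Finset.prod_mul_distrib, Finset.prod_const, ← Real.exp_sum, ← Finset.mul_sum,
            show (β - (1 - τ) * ∑ k ∈ s, y k) * t
              = (-0 * t ^ 2 + β * t) + -(1 - τ) * t * ∑ k ∈ s, y k by ring,
            Real.exp_add _ (-(1 - τ) * t * _)]
          ring
    have h2 : Tendsto (fun τ : ℝ => β - (1 - τ) * ∑ k ∈ s, y k) (𝓝[>] 0)
        (𝓝 (β - (1 - 0) * ∑ k ∈ s, y k)) := by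
      apply Tendsto.mono_left _ nhdsWithin_le_nhds
      exact Continuous.tendsto (by fun_prop) 0
    have h3 := ge_of_tendsto h2 (by
      filter_upwards [Ioc_mem_nhdsGT (zero_lt_one (α := ℝ))] with τ hτ using h1 τ hτ.1 hτ.2)
    linarith
  have hys : Summable y := summable_of_sum_le (fun k => (hy0 k).le) hsum
  refine ⟨hr, c, β - ∑' k, y k, 0, S, fun k => -x k,
    fun z => P z * Complex.exp (z * ((∑' k, y k : ℝ) : ℂ)),
    sub_nonneg.2 (hys.tsum_le_of_sum_le hsum), fun k => neg_pos.2 (hxneg k), ?_, fun z => ?_,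
    fun z => ?_⟩
  · refine hys.congr fun k => ?_
    rw [inv_neg]
  · have h1 : HasSum (fun k => z * (y k : ℂ)) (z * ((∑' k, y k : ℝ) : ℂ)) :=
      (Complex.hasSum_ofReal.2 hys.hasSum).mul_left z
    convert (hP z).mul h1.cexp using 2 with k
    have h2 : z * (y k : ℂ) = -(z / x k) := by simp only [hy]; push_cast; ring
    simp only [Function.comp_apply, h2]
    rw [mul_assoc, ← Complex.exp_add, add_neg_cancel, Complex.exp_zero]
    push_cast
    rw [div_neg]; ring
  · have : Complex.exp (-((0 : ℝ) : ℂ) * z ^ 2 + (β : ℂ) * z)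
        = Complex.exp (((β - ∑' k, y k : ℝ) : ℂ) * z)
          * Complex.exp (z * ((∑' k, y k : ℝ) : ℂ)) := by
      rw [← Complex.exp_add]
      congr 1
      push_cast
      ring
    rw [hfe z, this]
    ring

/-! ### Necessary conditions and conclusion -/

/-- Necessary conditions for type I: the first parameter exceeds `3`, and the smallest zero is at
distance at most `a` from the origin. -/
theorem exists_altPhi_eq_zero {a b : ℝ} (ha : 1 < a) (hab : a < b)
    (hf : LaguerrePolyaI (altFun a b)) : 3 < a ∧ ∃ x, 0 < x ∧ x ≤ a ∧ altPhi a b x = 0 := by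
  have hb : 1 < b := ha.trans hab
  obtain ⟨-, c, β, n, S, x, P, hβ, hx, hs, hP, hfe⟩ := hf
  have hP0 : P 0 = 1 := (hP 0).unique (by simp)
  have h0 := hfe 0
  rw [altFun_zero ha hb, hP0, mul_zero, Complex.exp_zero, mul_one, mul_one] at h0
  have hn : n = 0 := by
    by_contra hn
    rw [zero_pow hn, mul_zero] at h0
    exact one_ne_zero h0
  subst hn
  rw [pow_zero, mul_one] at h0
  have hy0 (k : S) : 0 ≤ (x k)⁻¹ := (inv_pos.2 (hx k)).le
  have hF : ∀ t, 0 < t → altReal a b t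
      = Real.exp (β * t + ∑' k, Real.log (1 + t * (x k)⁻¹)) := by
    intro t ht
    have hpos (k : S) : 0 < 1 + t * (x k)⁻¹ := by have := hy0 k; positivity
    have hl := Real.summable_log_one_add_of_summable (hs.mul_left t)
    have h1 := (Real.hasProd_of_hasSum_log hpos hl.hasSum).map Complex.ofRealHom
      Complex.continuous_ofReal
    have h2 : P t = ((Real.exp (∑' k, Real.log (1 + t * (x k)⁻¹)) : ℝ) : ℂ) := by
      refine (hP t).unique ?_
      refine h1.congr fun s => Finset.prod_congr rfl fun k _ => ?_
      simp [div_eq_mul_inv]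
    have h3 := hfe t
    rw [altFun_ofReal, ← h0, h2, pow_zero, one_mul, one_mul] at h3
    rw [Real.exp_add]
    exact_mod_cast h3
  have hc {m : WithTop ℕ∞} : ContDiff ℝ m (altReal a b) := contDiff_altReal ha hb
  have c0 : Continuous (altReal a b) := (hc (m := 0)).continuous
  have c1 : Continuous (deriv (altReal a b)) := (hc (m := 1)).continuous_deriv le_rfl
  have hc1 : ContDiff ℝ 2 (deriv (altReal a b)) := (hc (m := 3)).deriv'
  have hc2 : ContDiff ℝ 1 (deriv (deriv (altReal a b))) := hc1.deriv'
  have c2 : Continuous (deriv (deriv (altReal a b))) := hc2.continuous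
  have c3 : Continuous (deriv (deriv (deriv (altReal a b)))) := hc2.continuous_deriv le_rfl
  have limit {f g : ℝ → ℝ} (hf : Continuous f) (hg : Continuous g)
      (h : ∀ t, 0 < t → f t ≤ g t) : f 0 ≤ g 0 := by
    refine le_of_tendsto_of_tendsto (b := 𝓝[>] 0) (hf.continuousWithinAt) hg.continuousWithinAt ?_
    filter_upwards [self_mem_nhdsWithin] with t ht using h t ht
  -- At 0 the first inequality reads (4 - a)b ≤ 3. If a ≤ 3, then b > a gives a(4 - a) < 3, that is
  -- (a - 1)(a - 3) > 0, which is impossible for 1 < a ≤ 3.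
  have ha3 : 3 < a := by
    have h1 := limit (f := fun t => _) (g := fun t => _) (by fun_prop) (by fun_prop)
      fun t ht => (deriv_inequalities hβ hy0 hs hF ht).1
    simp only [altReal_zero ha hb, deriv_altReal_zero ha hb, deriv_deriv_altReal_zero ha hb,
      deriv_deriv_deriv_altReal_zero ha hb] at h1
    have h2 : (4 - a) * b ≤ 3 := by
      field_simp at h1
      nlinarith
    by_contra h
    nlinarith
  refine ⟨ha3, ?_⟩
  -- If every 1/x_k were below 1/a, the second inequality at 0 would read 1 - 2/a ≤ 1/a,
  -- contradicting a > 3.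
  have : ∃ k, a⁻¹ ≤ (x k)⁻¹ := by
    by_contra! h
    have h1 := limit (f := fun t => _) (g := fun t => _) (by fun_prop) (by fun_prop)
      fun t ht => (deriv_inequalities hβ hy0 hs hF ht).2 a⁻¹ (by positivity) fun k => (h k).le
    simp only [altReal_zero ha hb, deriv_altReal_zero ha hb, deriv_deriv_altReal_zero ha hb] at h1
    field_simp at h1
    linarith
  obtain ⟨k, hk⟩ := this
  refine ⟨x k, hx k, (inv_le_inv₀ (by linarith) (hx k)).1 hk, ?_⟩
  have h1 : P (-(x k : ℂ)) = 0 := (hP _).unique (hasProd_zero_of_exists_eq_zero ⟨k, by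
    have : (x k : ℂ) ≠ 0 := by exact_mod_cast (hx k).ne'
    rw [neg_div, div_self this, add_neg_cancel]⟩)
  have h2 := altFun_neg_ofReal a b (x k)
  rw [hfe, h1, mul_zero] at h2
  exact_mod_cast h2.symm

theorem IsAlternatingQuotientFunction.laguerrePolyaI_iff {a b : ℝ} (ha : 1 < a) (hb : 1 < b)
    {f : ℂ → ℂ} (hf : IsAlternatingQuotientFunction a b f) :
    LaguerrePolyaI f ↔ LaguerrePolyaI (altFun a b) := by
  obtain ⟨c, l, hc, hl, hfe⟩ := hf.exists_eq ha hb
  constructor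
  · intro h
    convert h.const_mul_comp_mul c⁻¹ (inv_pos.2 hl) using 1
    funext z
    have : (c : ℂ) ≠ 0 := by exact_mod_cast hc.ne'
    have : (l : ℂ) ≠ 0 := by exact_mod_cast hl.ne'
    rw [hfe]
    push_cast
    field_simp
  · intro h
    rw [funext hfe]
    exact h.const_mul_comp_mul c hl

theorem IsAlternatingQuotientFunction.laguerrePolyaI {a b : ℝ} (ha : 1 < a) (hb : 1 < b)
    {f : ℂ → ℂ} (hf : IsAlternatingQuotientFunction a b f) (h : LaguerrePolya f) :
    LaguerrePolyaI f := by
  obtain ⟨c, l, hc, hl, hfe⟩ := hf.exists_eq ha hb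
  refine h.laguerrePolyaI hc fun x hx => ?_
  have h1 : 1 ≤ altReal a b (l * x) := by
    rcases hx.eq_or_lt with rfl | hx
    · rw [mul_zero, altReal_zero ha hb]
    · exact one_le_altReal ha hb (by positivity)
  rw [hfe, show (l : ℂ) * x = ((l * x : ℝ) : ℂ) by push_cast; rfl, altFun_ofReal, norm_mul,
    Complex.norm_of_nonneg hc.le, Complex.norm_of_nonneg (by linarith)]
  nlinarith

theorem qInfty_le {a : ℝ} (ha : 1 < a) (h : LaguerrePolyaI (altFun a a)) : qInfty ≤ a := by
  refine csInf_le ⟨0, ?_⟩ ⟨√a, ?_, ?_, (Real.sq_sqrt (by linarith)).symm⟩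
  · rintro q ⟨t, -, -, rfl⟩
    positivity
  · rw [Real.lt_sqrt] <;> linarith
  · have h1 := h.const_mul_comp_mul 1 (l := (√a)⁻¹) (by positivity)
    convert h1.laguerrePolya using 1
    funext z
    rw [partialTheta_eq_altFun ha]
    push_cast
    ring_nf

theorem theorem2 (a b : ℝ) (ha : 1 < a) (hab : a < b) (f : ℂ → ℂ)
    (hf : IsAlternatingQuotientFunction a b f) :
    (LaguerrePolyaI f → qInfty ≤ a) ∧
    (qInfty ≤ a → LaguerrePolyaI f →
      ∀ c : ℝ, a < c → c < b →
        ∀ g : ℂ → ℂ, IsAlternatingQuotientFunction a c g → LaguerrePolyaI g) ∧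
    (qInfty ≤ a → LaguerrePolya f →
      ∀ d : ℝ, a < d → d < b →
        ∀ g : ℂ → ℂ, IsAlternatingQuotientFunction d b g → LaguerrePolyaI g) := by
  have hb : 1 < b := ha.trans hab
  have key : LaguerrePolyaI f → 3 < a ∧ ∃ x, 0 < x ∧ x ≤ a ∧ altPhi a b x = 0 := fun h =>
    exists_altPhi_eq_zero ha hab ((hf.laguerrePolyaI_iff ha hb).1 h)
  refine ⟨fun h => ?_, fun _ h c hac hcb g hg => ?_, fun _ h d had hdb g hg => ?_⟩
  · obtain ⟨h3, x, hx0, hxa, hx⟩ := key h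
    exact qInfty_le ha (laguerrePolyaI_altFun h3.le le_rfl hx0 hxa
      (hx ▸ altPhi_lt_altPhi_right h3.le h3.le hab hx0 hxa))
  · obtain ⟨h3, x, hx0, hxa, hx⟩ := key h
    rw [hg.laguerrePolyaI_iff ha (ha.trans hac)]
    exact laguerrePolyaI_altFun h3.le hac.le hx0 hxa
      (hx ▸ altPhi_lt_altPhi_right h3.le (h3.trans hac).le hcb hx0 hxa)
  · obtain ⟨h3, x, hx0, hxa, hx⟩ := key (hf.laguerrePolyaI ha hb h)
    rw [hg.laguerrePolyaI_iff (ha.trans had) hb]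
    exact laguerrePolyaI_altFun (h3.trans had).le hdb.le hx0 (hxa.trans had.le)
      (hx ▸ altPhi_lt_altPhi_left h3.le (h3.trans hab).le had hx0 hxa)
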